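/- Let $\mathcal X_1,\mathcal X_2,\mathcal X_3,\mathcal Z$ be finite-dimensional real inner product spaces, $\theta_i:\mathcal X_i\to(-\infty,+\infty]$ closed proper convex functions, $A_i:\mathcal Z\to\mathcal X_i$ linear operators with adjoints $A_i^*$ ($i=1,2,3$), and $c\in\mathcal Z$. Write $A^*x=A_1^*x_1+A_2^*x_2+A_3^*x_3$ and $\theta(x)=\theta_1(x_1)+\theta_2(x_2)+\theta_3(x_3)$, and consider $$\text{(P)}\qquad \min_{x_1,x_2,x_3}\ \{\theta(x)\ :\ A^*x=c\},$$ whose set of optimal solutions is assumed nonempty. Its dual is the maximization over $z\in\mathcal Z$ of $\inf_x\{\theta(x)+\langle z,A^*x-c\rangle\}$. Let $\Sigma_i$ be self-adjoint positive semidefinite operators on $\mathcal X_i$ with $$\langle \hat x_i-x_i,\hat w_i-w_i\rangle\ \ge\ \langle\hat x_i-x_i,\Sigma_i(\hat x_i-x_i)\rangle\quad\text{for all }\hat x_i,x_i\in\operatorname{dom}\theta_i,\ \hat w_i\in\partial\theta_i(\hat x_i),\ w_i\in\partial\theta_i(x_i).$$ Let $\sigma>0$, $\tau>0$, let $T_i$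 be self-adjoint positive semidefinite operators on $\mathcal X_i$, and write $\|x\|_G^2=\langle x,Gx\rangle$ for self-adjoint $G$. Let $$\mathcal L_\sigma(x_1,x_2,x_3;z)=\theta(x)+\langle z,A^*x-c\rangle+\tfrac{\sigma}{2}\|A^*x-c\|^2 .$$ Assume that: (i) $\Sigma_2\succ0$; (ii) the sequence $(x_1^k,x_2^k,x_3^k,z^k)_{k\ge0}$, with $x_i^0\in\operatorname{dom}\theta_i$ and $z^0\in\mathcal Z$, is well defined and generated by the 3-block semi-proximal ADMM, that is, for all $k\ge0$, $$x_1^{k+1}\in\arg\min_{x_1}\{\mathcal L_\sigma(x_1,x_2^k,x_3^k;z^k)+\tfrac12\|x_1-x_1^k\|_{T_1}^2\},$$ $$x_2^{k+1}\in\arg\min_{x_2}\{\mathcal L_\sigma(x_1^{k+1},x_2,x_3^k;z^k)+\tfrac12\|x_2-x_2^k\|_{T_2}^2\},$$ $$x_3^{k+1}\in\arg\min_{x_3}\{\mathcal L_\sigma(x_1^{k+1},x_2^{k+1},x_3;z^k)+\tfrac12\|x_3-x_3^k\|_{T_3}^2\},$$ $$z^{k+1}=z^k+\tau\sigma(A^*x^{k+1}-c);$$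 (iii) there is a point $x'\in\operatorname{ri}(\operatorname{dom}\theta_1\times\operatorname{dom}\theta_2\times\operatorname{dom}\theta_3)$ with $A^*x'=c$. Put $u=(x_2,x_3)\in\mathcal X_2\times\mathcal X_3$, $B=\begin{pmatrix}A_2\\A_3\end{pmatrix}:\mathcal Z\to\mathcal X_2\times\mathcal X_3$, $r^k=A^*x^k-c$, $\Delta x_i^k=x_i^{k+1}-x_i^k$, $\Delta u^k=u^{k+1}-u^k$, $K=(A_2A_3^*)^*\Sigma_2^{-1}(A_2A_3^*)$ and, for $\alpha\in(0,1]$, $$M=\begin{pmatrix}(1-\alpha)\Sigma_2+T_2&0\\0&\Sigma_3+T_3\end{pmatrix}+\sigma BB^*,$$ $$H=\begin{pmatrix}\frac{5(1-\alpha)}2\Sigma_2+T_2&0\\0&\frac52\Sigma_3+T_3-\frac{5\sigma^2}{2\alpha}K\end{pmatrix}+\min(\tau,1+\tau-\tau^2)\,\sigma BB^*.$$ For $(\bar x_1,\bar x_2,\bar x_3,\bar z)$ satisfying the optimality system $-A_i\bar z\in\partial\theta_i(\bar x_i)$ ($i=1,2,3$), $A^*\bar x=c$, and with $\bar u=(\bar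 x_2,\bar x_3)$, put $$\overline\phi_k=(\sigma\tau)^{-1}\|z^k-\bar z\|^2+\|x_1^k-\bar x_1\|^2_{\Sigma_1+T_1}+\|u^k-\bar u\|_M^2,$$ $$\xi_{k+1}=\|\Delta x_2^k\|_{T_2}^2+\|\Delta x_3^k\|^2_{T_3+\frac{\sigma^2}{\alpha}K},\qquad t_{k+1}=\|\Delta x_1^k\|^2_{\frac12\Sigma_1+T_1}+\|\Delta u^k\|_H^2 .$$ Then, for every $\tau>0$, every $\alpha\in(0,1]$, every such $(\bar x,\bar z)$ and every integer $k\ge1$, $$\bigl(\overline\phi_k+\max(1-\tau,1-\tau^{-1})\sigma\|r^k\|^2+\xi_k\bigr)-\bigl(\overline\phi_{k+1}+\max(1-\tau,1-\tau^{-1})\sigma\|r^{k+1}\|^2+\xi_{k+1}\bigr)\ \ge\ t_{k+1}+\min(\tau,1+\tau-\tau^2)\,\sigma\tau^{-1}\|r^{k+1}\|^2 .$$ If in addition $\tau\in(0,(1+\sqrt5)/2)$ and, for some $\alpha\in(0,1]$, $$\tfrac12\Sigma_1+T_1+\sigma A_1A_1^*\succ0,\qquad H\succ0,\qquad M\succ0,$$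 then the whole sequence $(x_1^k,x_2^k,x_3^k)$ converges to an optimal solution of (P), and $z^k$ converges to an optimal solution of the dual of (P). -/

import Mathlib

open Filter Topology Set
open scoped InnerProductSpace

noncomputable section

namespace SPADMM

/-! Convex analysis of functions with values in `(-∞, +∞]`. -/

section Basic

variable {E F : Type*} [NormedAddCommGroup E] [InnerProductSpace ℝ E]
  [NormedAddCommGroup F] [InnerProductSpace ℝ F]

/-- The effective domain of an extended-real-valued function. -/
def dom (f : E → EReal) : Set E := {x | f x < ⊤}

/-- Closed (lower semicontinuous) proper convex functions `E → (-∞, +∞]`;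
convexity is convexity of the epigraph. -/
structure ClosedProperConvex (f : E → EReal) : Prop where
  ne_bot : ∀ x, f x ≠ ⊥
  dom_nonempty : (dom f).Nonempty
  closed : LowerSemicontinuous f
  convex : Convex ℝ {p : E × ℝ | f p.1 ≤ (p.2 : EReal)}

/-- The subdifferential `∂f(x)`. -/
def subdiff (f : E → EReal) (x : E) : Set E :=
  {w | ∀ y, f x + ((⟪w, y - x⟫_ℝ : ℝ) : EReal) ≤ f y}

/-- `‖x‖_G^2 = ⟨x, G x⟩`. -/
def sqNorm (G : E →ₗ[ℝ] E) (x : E) : ℝ := ⟪x, G x⟫_ℝ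

/-- `⟨x' - x, w' - w⟩ ≥ ‖x' - x‖_S^2` for all `w' ∈ ∂f(x')`, `w ∈ ∂f(x)`. -/
def MonotoneWith (f : E → EReal) (S : E →ₗ[ℝ] E) : Prop :=
  ∀ x' ∈ dom f, ∀ x ∈ dom f, ∀ w' ∈ subdiff f x', ∀ w ∈ subdiff f x,
    sqNorm S (x' - x) ≤ ⟪x' - x, w' - w⟫_ℝ

/-- `S ≻ 0`: self-adjoint and positive definite. -/
def PosDef (S : E →ₗ[ℝ] E) : Prop :=
  S.IsSymmetric ∧ ∀ x, x ≠ 0 → 0 < sqNorm S x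

/-- The block diagonal operator `diag(P, Q)` on the Euclidean product space. -/
def blockDiag (P : E →ₗ[ℝ] E) (Q : F →ₗ[ℝ] F) :
    WithLp 2 (E × F) →ₗ[ℝ] WithLp 2 (E × F) :=
  (WithLp.linearEquiv 2 ℝ (E × F)).symm.toLinearMap ∘ₗ P.prodMap Q ∘ₗ
    (WithLp.linearEquiv 2 ℝ (E × F)).toLinearMap

/-- The increment `Δx^k = x^{k+1} - x^k` of a sequence. -/
def incr (x : ℕ → E) (k : ℕ) : E := x (k + 1) - x k

end Basic

/-- The data of the problem
`min θ₁(x₁) + θ₂(x₂) + θ₃(x₃)` subject to `A₁* x₁ + A₂* x₂ + A₃* x₃ = c`. -/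
structure Problem (X₁ X₂ X₃ Z : Type*)
    [NormedAddCommGroup X₁] [InnerProductSpace ℝ X₁]
    [NormedAddCommGroup X₂] [InnerProductSpace ℝ X₂]
    [NormedAddCommGroup X₃] [InnerProductSpace ℝ X₃]
    [NormedAddCommGroup Z] [InnerProductSpace ℝ Z] where
  θ₁ : X₁ → EReal
  θ₂ : X₂ → EReal
  θ₃ : X₃ → EReal
  A₁ : Z →ₗ[ℝ] X₁
  A₂ : Z →ₗ[ℝ] X₂
  A₃ : Z →ₗ[ℝ] X₃
  c : Z

/-- The parameters: penalty `σ`, step-length `τ`, the operators `Sᵢ` (written `Σᵢ` in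
mathematical notation) and the semi-proximal operators `Tᵢ`. -/
structure Params (X₁ X₂ X₃ : Type*)
    [NormedAddCommGroup X₁] [InnerProductSpace ℝ X₁]
    [NormedAddCommGroup X₂] [InnerProductSpace ℝ X₂]
    [NormedAddCommGroup X₃] [InnerProductSpace ℝ X₃] where
  σ : ℝ
  τ : ℝ
  S₁ : X₁ →ₗ[ℝ] X₁
  S₂ : X₂ →ₗ[ℝ] X₂
  S₃ : X₃ →ₗ[ℝ] X₃
  T₁ : X₁ →ₗ[ℝ] X₁
  T₂ : X₂ →ₗ[ℝ] X₂
  T₃ : X₃ →ₗ[ℝ] X₃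

/-- A sequence `(x₁^k, x₂^k, x₃^k, z^k)`. -/
structure Iterates (X₁ X₂ X₃ Z : Type*) where
  x₁ : ℕ → X₁
  x₂ : ℕ → X₂
  x₃ : ℕ → X₃
  z : ℕ → Z

section Main

variable {X₁ X₂ X₃ Z : Type*}
  [NormedAddCommGroup X₁] [InnerProductSpace ℝ X₁] [FiniteDimensional ℝ X₁]
  [NormedAddCommGroup X₂] [InnerProductSpace ℝ X₂] [FiniteDimensional ℝ X₂]
  [NormedAddCommGroup X₃] [InnerProductSpace ℝ X₃] [FiniteDimensional ℝ X₃]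
  [NormedAddCommGroup Z] [InnerProductSpace ℝ Z] [FiniteDimensional ℝ Z]

namespace Problem

variable (P : Problem X₁ X₂ X₃ Z)

/-- The objective `θ(x) = θ₁(x₁) + θ₂(x₂) + θ₃(x₃)`. -/
def obj (x₁ : X₁) (x₂ : X₂) (x₃ : X₃) : EReal := P.θ₁ x₁ + P.θ₂ x₂ + P.θ₃ x₃

/-- The residual `A* x - c = A₁* x₁ + A₂* x₂ + A₃* x₃ - c`. -/
def residual (x₁ : X₁) (x₂ : X₂) (x₃ : X₃) : Z :=
  P.A₁.adjoint x₁ + P.A₂.adjoint x₂ + P.A₃.adjoint x₃ - P.c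

/-- The augmented Lagrangian `L_σ(x₁, x₂, x₃; z)`; `σ = 0` gives the ordinary Lagrangian. -/
def augLagrangian (σ : ℝ) (x₁ : X₁) (x₂ : X₂) (x₃ : X₃) (z : Z) : EReal :=
  P.obj x₁ x₂ x₃ +
    ((⟪z, P.residual x₁ x₂ x₃⟫_ℝ + σ / 2 * ‖P.residual x₁ x₂ x₃‖ ^ 2 : ℝ) : EReal)

/-- `(x₁, x₂, x₃)` is an optimal solution of the primal problem. -/
def IsOptimal (x₁ : X₁) (x₂ : X₂) (x₃ : X₃) : Prop :=
  P.obj x₁ x₂ x₃ < ⊤ ∧ P.residual x₁ x₂ x₃ = 0 ∧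
    ∀ y₁ y₂ y₃, P.residual y₁ y₂ y₃ = 0 → P.obj x₁ x₂ x₃ ≤ P.obj y₁ y₂ y₃

/-- The dual objective `z ↦ inf_x {θ(x) + ⟨z, A* x - c⟩}`. -/
def dualObj (z : Z) : EReal :=
  ⨅ x : X₁ × X₂ × X₃, P.augLagrangian 0 x.1 x.2.1 x.2.2 z

/-- `z` is an optimal solution of the dual problem (maximization of `dualObj`). -/
def IsDualOptimal (z : Z) : Prop :=
  ⊥ < P.dualObj z ∧ ∀ z', P.dualObj z' ≤ P.dualObj z

/-- The optimality system `-Aᵢ z ∈ ∂θᵢ(xᵢ)`, `i = 1, 2, 3`, and `A* x - c = 0`. -/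
def IsKKT (x₁ : X₁) (x₂ : X₂) (x₃ : X₃) (z : Z) : Prop :=
  -P.A₁ z ∈ subdiff P.θ₁ x₁ ∧ -P.A₂ z ∈ subdiff P.θ₂ x₂ ∧ -P.A₃ z ∈ subdiff P.θ₃ x₃ ∧
    P.residual x₁ x₂ x₃ = 0

/-- The operator `B = (A₂; A₃) : Z → X₂ × X₃`. -/
def B : Z →ₗ[ℝ] WithLp 2 (X₂ × X₃) :=
  (WithLp.linearEquiv 2 ℝ (X₂ × X₃)).symm.toLinearMap ∘ₗ P.A₂.prod P.A₃

/-- The constraint qualification: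
`ri (dom θ₁ × dom θ₂ × dom θ₃) ∩ {x | A* x = c}` is nonempty. -/
def ConstraintQualification : Prop :=
  ∃ x ∈ intrinsicInterior ℝ (dom P.θ₁ ×ˢ (dom P.θ₂ ×ˢ dom P.θ₃)),
    P.residual x.1 x.2.1 x.2.2 = 0

end Problem

variable (P : Problem X₁ X₂ X₃ Z) (Q : Params X₁ X₂ X₃)

/-- `s` is an (infinite) sequence generated by the 3-block semi-proximal ADMM. -/
structure IsGenerated (s : Iterates X₁ X₂ X₃ Z) : Prop where
  init₁ : s.x₁ 0 ∈ dom P.θ₁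
  init₂ : s.x₂ 0 ∈ dom P.θ₂
  init₃ : s.x₃ 0 ∈ dom P.θ₃
  step₁ : ∀ k, IsMinOn (fun y => P.augLagrangian Q.σ y (s.x₂ k) (s.x₃ k) (s.z k) +
    ((1 / 2 * sqNorm Q.T₁ (y - s.x₁ k) : ℝ) : EReal)) univ (s.x₁ (k + 1))
  step₂ : ∀ k, IsMinOn (fun y => P.augLagrangian Q.σ (s.x₁ (k + 1)) y (s.x₃ k) (s.z k) +
    ((1 / 2 * sqNorm Q.T₂ (y - s.x₂ k) : ℝ) : EReal)) univ (s.x₂ (k + 1))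
  step₃ : ∀ k, IsMinOn (fun y => P.augLagrangian Q.σ (s.x₁ (k + 1)) (s.x₂ (k + 1)) y (s.z k) +
    ((1 / 2 * sqNorm Q.T₃ (y - s.x₃ k) : ℝ) : EReal)) univ (s.x₃ (k + 1))
  stepz : ∀ k, s.z (k + 1) = s.z k +
    (Q.τ * Q.σ) • P.residual (s.x₁ (k + 1)) (s.x₂ (k + 1)) (s.x₃ (k + 1))

/-- `(A₂ A₃*)* Σ₂⁻¹ (A₂ A₃*)`; the ring inverse is the true inverse when `Σ₂ ≻ 0`. -/
def crossOp : X₃ →ₗ[ℝ] X₃ :=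
  (P.A₂ ∘ₗ P.A₃.adjoint).adjoint ∘ₗ (Ring.inverse Q.S₂ : X₂ →ₗ[ℝ] X₂) ∘ₗ
    (P.A₂ ∘ₗ P.A₃.adjoint)

/-- `M = diag((1-α)Σ₂ + T₂, Σ₃ + T₃) + σ B B*`. -/
def opM (α : ℝ) : WithLp 2 (X₂ × X₃) →ₗ[ℝ] WithLp 2 (X₂ × X₃) :=
  blockDiag ((1 - α) • Q.S₂ + Q.T₂) (Q.S₃ + Q.T₃) + Q.σ • (P.B ∘ₗ P.B.adjoint)

/-- `H = diag((5(1-α)/2)Σ₂ + T₂, (5/2)Σ₃ + T₃ - (5σ²/(2α)) (A₂A₃*)*Σ₂⁻¹(A₂A₃*))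
+ min(τ, 1+τ-τ²) σ B B*`. -/
def opH (α : ℝ) : WithLp 2 (X₂ × X₃) →ₗ[ℝ] WithLp 2 (X₂ × X₃) :=
  blockDiag ((5 * (1 - α) / 2) • Q.S₂ + Q.T₂)
      ((5 / 2 : ℝ) • Q.S₃ + Q.T₃ - (5 * Q.σ ^ 2 / (2 * α)) • crossOp P Q) +
    (min Q.τ (1 + Q.τ - Q.τ ^ 2) * Q.σ) • (P.B ∘ₗ P.B.adjoint)

/-- `φ_k(x₁, u, z)` at `u = (x₂, x₃)`. -/
def phi (α : ℝ) (s : Iterates X₁ X₂ X₃ Z) (x₁ : X₁) (x₂ : X₂) (x₃ : X₃) (z : Z) (k : ℕ) : ℝ :=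
  (Q.σ * Q.τ)⁻¹ * ‖s.z k - z‖ ^ 2 + sqNorm (Q.S₁ + Q.T₁) (s.x₁ k - x₁) +
    sqNorm (opM P Q α) (WithLp.toLp 2 (s.x₂ k - x₂, s.x₃ k - x₃))

/-- `ξ_k`, for `k ≥ 1`:
`ξ_{k+1} = ‖Δx₂^k‖²_{T₂} + ‖Δx₃^k‖²_{T₃ + (σ²/α)(A₂A₃*)*Σ₂⁻¹(A₂A₃*)}`. -/
def xi (α : ℝ) (s : Iterates X₁ X₂ X₃ Z) (k : ℕ) : ℝ :=
  sqNorm Q.T₂ (incr s.x₂ (k - 1)) +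
    sqNorm (Q.T₃ + (Q.σ ^ 2 / α) • crossOp P Q) (incr s.x₃ (k - 1))

/-- `t_k`, for `k ≥ 1`: `t_{k+1} = ‖Δx₁^k‖²_{Σ₁/2 + T₁} + ‖Δu^k‖²_H`. -/
def t (α : ℝ) (s : Iterates X₁ X₂ X₃ Z) (k : ℕ) : ℝ :=
  sqNorm ((1 / 2 : ℝ) • Q.S₁ + Q.T₁) (incr s.x₁ (k - 1)) +
    sqNorm (opH P Q α) (WithLp.toLp 2 (incr s.x₂ (k - 1), incr s.x₃ (k - 1)))

/-- `r^k = A* x^k - c`. -/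
def res (s : Iterates X₁ X₂ X₃ Z) (k : ℕ) : Z := P.residual (s.x₁ k) (s.x₂ k) (s.x₃ k)

/-- The merit quantity `φ_k(x₁, u, z) + max(1-τ, 1-τ⁻¹) σ ‖r^k‖² + ξ_k`. -/
def merit (α : ℝ) (s : Iterates X₁ X₂ X₃ Z) (x₁ : X₁) (x₂ : X₂) (x₃ : X₃) (z : Z)
    (k : ℕ) : ℝ :=
  phi P Q α s x₁ x₂ x₃ z k + max (1 - Q.τ) (1 - Q.τ⁻¹) * Q.σ * ‖res P s k‖ ^ 2 + xi P Q α s k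

end Main

end SPADMM

end

set_option linter.unusedSectionVars false

namespace SPADMM

/-! ### Extended-real convex functions and their subdifferentials -/

section ConvexAnalysis

variable {E : Type*} [NormedAddCommGroup E] [InnerProductSpace ℝ E] {f : E → EReal}

/-! Each block minimization produces a subgradient of θᵢ at the new iterate
(`IsGenerated.mem_subdiff₁` and its analogues). Pairing these with the subgradients at a KKT point
by the strengthened monotonicity, and completing squares through the multiplier update
(`inner_residual_identity`), gives a decrease of `phi` (`IsGenerated.phi_sub_phi_ge`). Compared with
two blocks there is one new term, 2σ⟨A₂*(x₂^{k+1} - x̄₂), A₃*Δx₃^k⟩, because block 2 is updated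
against the old block 3. As Σ₂ ≻ 0, Young's inequality absorbs it into a fraction α of Σ₂ at the
price of a multiple of K in Δx₃; hence the 1-α in M and H.

The cross term ⟨r^{k+1}, B*Δu^k⟩ is handled by monotonicity between consecutive iterates of blocks 2
and 3 (`IsGenerated.inner_res_incr_le`), which trades it for (1-τ)⟨r^k, B*Δu^k⟩ and telescoping
terms gathered in `xi`. A completed square (`min_residual_le`) then gives the descent inequality
`IsGenerated.t_add_le_merit_sub`.

For τ below the golden ratio the merit is nonnegative and nonincreasing, so residuals and increments
vanish (`tendsto_incr_zero`). The merit and the residual bound the iterates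
(`exists_norm_sq_sub_le`), and cluster points are KKT points because subdifferential graphs are
closed. Taking a cluster point as the reference point, the merit tends to 0 along a subsequence,
hence entirely, and the whole sequence converges. A first KKT point comes from the constraint
qualification via `exists_lagrange_multiplier`. -/

theorem ClosedProperConvex.coe_toReal (hf : ClosedProperConvex f) {x : E} (hx : x ∈ dom f) :
    ((f x).toReal : EReal) = f x :=
  EReal.coe_toReal (ne_of_lt hx) (hf.ne_bot x)

theorem ClosedProperConvex.convexOn_toReal (hf : ClosedProperConvex f) :
    ConvexOn ℝ (dom f) fun x => (f x).toReal := by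
  have key : ∀ x ∈ dom f, ∀ y ∈ dom f, ∀ a b : ℝ, 0 ≤ a → 0 ≤ b → a + b = 1 →
      f (a • x + b • y) ≤ ((a * (f x).toReal + b * (f y).toReal : ℝ) : EReal) := by
    intro x hx y hy a b ha hb hab
    have := hf.convex (x := (x, (f x).toReal)) (by simp [hf.coe_toReal hx])
      (y := (y, (f y).toReal)) (by simp [hf.coe_toReal hy]) ha hb hab
    simpa using this
  refine ⟨fun x hx y hy a b ha hb hab =>
    (key x hx y hy a b ha hb hab).trans_lt (EReal.coe_lt_top _), ?_⟩
  intro x hx y hy a b ha hb hab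
  have h := key x hx y hy a b ha hb hab
  rw [← hf.coe_toReal (h.trans_lt (EReal.coe_lt_top _)), EReal.coe_le_coe_iff] at h
  exact h

theorem ClosedProperConvex.mem_dom_of_mem_subdiff (hf : ClosedProperConvex f) {x w : E}
    (hw : w ∈ subdiff f x) : x ∈ dom f := by
  obtain ⟨y, hy⟩ := hf.dom_nonempty
  have h := (hw y).trans_lt hy
  by_contra hx
  have hx' : f x = ⊤ := by simpa [dom] using hx
  rw [hx', EReal.top_add_coe] at h
  exact lt_irrefl _ h

theorem ClosedProperConvex.mem_subdiff_iff (hf : ClosedProperConvex f) {x w : E}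
    (hx : x ∈ dom f) :
    w ∈ subdiff f x ↔ ∀ y ∈ dom f, (f x).toReal + ⟪w, y - x⟫_ℝ ≤ (f y).toReal := by
  constructor
  · intro h y hy
    have := h y
    rw [← hf.coe_toReal hx, ← hf.coe_toReal hy] at this
    exact_mod_cast this
  · intro h y
    by_cases hy : y ∈ dom f
    · rw [← hf.coe_toReal hx, ← hf.coe_toReal hy]
      exact_mod_cast h y hy
    · have : f y = ⊤ := by simpa [dom] using hy
      simp [this]

theorem ClosedProperConvex.mem_dom_of_isMinOn (hf : ClosedProperConvex f) {q : E → ℝ} {x : E}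
    (hmin : IsMinOn (fun y => f y + (q y : EReal)) univ x) : x ∈ dom f := by
  obtain ⟨y, hy⟩ := hf.dom_nonempty
  have h := hmin (mem_univ y)
  simp only [mem_ofPred_eq] at h
  by_contra hx
  have hx' : f x = ⊤ := by simpa [dom] using hx
  rw [hx', EReal.top_add_coe, ← hf.coe_toReal hy] at h
  exact absurd (h.trans_lt (by exact_mod_cast EReal.coe_lt_top ((f y).toReal + q y)))
    (lt_irrefl _)

theorem nonneg_of_forall_add_mul_nonneg {a b : ℝ}
    (h : ∀ t : ℝ, 0 < t → t ≤ 1 → 0 ≤ a + t * b) : 0 ≤ a := by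
  have ht : Tendsto (fun t : ℝ => a + t * b) (𝓝[>] 0) (𝓝 a) := by
    have : Continuous fun t : ℝ => a + t * b := by fun_prop
    simpa using (this.tendsto 0).mono_left nhdsWithin_le_nhds
  refine ge_of_tendsto ht ?_
  filter_upwards [Ioc_mem_nhdsGT (zero_lt_one' ℝ)] with t ht
  exact h t ht.1 ht.2

/-- First order optimality for the sum of a convex function and a quadratic. -/
theorem ClosedProperConvex.neg_mem_subdiff_of_isMinOn (hf : ClosedProperConvex f) {q C : E → ℝ}
    {x g : E} (hmin : IsMinOn (fun y => f y + (q y : EReal)) univ x)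
    (hq : ∀ y, ∀ t : ℝ, q (x + t • (y - x)) = q x + t * ⟪g, y - x⟫_ℝ + t ^ 2 * C y) :
    -g ∈ subdiff f x := by
  have hx := hf.mem_dom_of_isMinOn hmin
  refine (hf.mem_subdiff_iff hx).2 fun y hy => ?_
  have hc := hf.convexOn_toReal
  suffices h : 0 ≤ (f y).toReal - (f x).toReal + ⟪g, y - x⟫_ℝ by
    rw [inner_neg_left]; linarith
  refine nonneg_of_forall_add_mul_nonneg (b := C y) fun t ht ht1 => ?_
  have e : (1 - t) • x + t • y = x + t • (y - x) := by module
  have hyd := hc.1 hx hy (sub_nonneg.2 ht1) ht.le (by ring)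
  have hyv := hc.2 hx hy (sub_nonneg.2 ht1) ht.le (by ring)
  rw [e] at hyd
  simp only [e, smul_eq_mul] at hyv
  have h := hmin (mem_univ (x + t • (y - x)))
  simp only [mem_ofPred_eq] at h
  rw [← hf.coe_toReal hx, ← hf.coe_toReal hyd, ← EReal.coe_add, ← EReal.coe_add,
    EReal.coe_le_coe_iff, hq] at h
  have : 0 ≤ t * ((f y).toReal - (f x).toReal + ⟪g, y - x⟫_ℝ + t * C y) := by nlinarith
  exact (mul_nonneg_iff_of_pos_left ht).1 this

/-- The graph of the subdifferential of a closed convex function is closed. -/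
theorem ClosedProperConvex.mem_subdiff_of_tendsto (hf : ClosedProperConvex f) {x w : ℕ → E}
    {x₀ w₀ : E} (hmem : ∀ n, w n ∈ subdiff f (x n)) (hx : Tendsto x atTop (𝓝 x₀))
    (hw : Tendsto w atTop (𝓝 w₀)) : w₀ ∈ subdiff f x₀ := by
  -- Real minorants `c` of `f x₀` cover the cases of finite and infinite value at once: an infinite
  -- value would allow `c` arbitrarily large, which is absurd.
  have hlt : ∀ y ∈ dom f, ∀ c : ℝ, (c : EReal) < f x₀ → c + ⟪w₀, y - x₀⟫_ℝ ≤ (f y).toReal := by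
    intro y hy c hc
    have hT : Tendsto (fun n => c + ⟪w n, y - x n⟫_ℝ) atTop (𝓝 (c + ⟪w₀, y - x₀⟫_ℝ)) :=
      tendsto_const_nhds.add (hw.inner (tendsto_const_nhds.sub hx))
    refine le_of_tendsto hT ?_
    filter_upwards [hx.eventually (hf.closed x₀ c hc)] with n hn
    have hd := hf.mem_dom_of_mem_subdiff (hmem n)
    have h := (hf.mem_subdiff_iff hd).1 (hmem n) y hy
    rw [← hf.coe_toReal hd, gt_iff_lt, EReal.coe_lt_coe_iff] at hn
    linarith
  have hd : x₀ ∈ dom f := by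
    by_contra hx'
    have hx' : f x₀ = ⊤ := by simpa [dom] using hx'
    obtain ⟨y, hy⟩ := hf.dom_nonempty
    have := hlt y hy ((f y).toReal - ⟪w₀, y - x₀⟫_ℝ + 1) (by rw [hx']; exact EReal.coe_lt_top _)
    linarith
  refine (hf.mem_subdiff_iff hd).2 fun y hy => le_of_forall_pos_le_add fun ε hε => ?_
  have := hlt y hy ((f x₀).toReal - ε) (by
    rw [← hf.coe_toReal hd, EReal.coe_lt_coe_iff]; simpa using hε)
  linarith

end ConvexAnalysis

/-! ### Lagrange multipliers under a relative interior condition -/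

section Multiplier

/-- A point of the relative interior of `D` can be moved slightly beyond itself, away from any
other point of `D`. -/
theorem exists_pos_sub_smul_mem_of_mem_intrinsicInterior {X : Type*} [NormedAddCommGroup X]
    [NormedSpace ℝ X] {D : Set X} {x d : X} (hx : x ∈ intrinsicInterior ℝ D) (hd : d ∈ D) :
    ∃ ε : ℝ, 0 < ε ∧ x - ε • (d - x) ∈ D := by
  obtain ⟨y, hy, rfl⟩ := hx
  have hds : d ∈ affineSpan ℝ D := subset_affineSpan ℝ D hd
  have hm : ∀ t : ℝ, AffineMap.lineMap (y : X) d (-t) ∈ affineSpan ℝ D := fun t =>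
    AffineMap.lineMap_mem _ y.2 hds
  -- The line is viewed inside the affine span, where the relative interior is an open set.
  let γ : ℝ → affineSpan ℝ D := fun t => ⟨AffineMap.lineMap (y : X) d (-t), hm t⟩
  have hγ : Continuous γ := by
    refine Continuous.subtype_mk ?_ _
    simp only [AffineMap.lineMap_apply_module]
    fun_prop
  have hγ0 : γ 0 = y := by ext; simp [γ]
  have hmem : ∀ᶠ t in 𝓝 (0 : ℝ), γ t ∈ interior ((↑) ⁻¹' D : Set (affineSpan ℝ D)) :=
    hγ.continuousAt.eventually (by rw [hγ0]; exact isOpen_interior.mem_nhds hy)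
  obtain ⟨t, ht, ht0⟩ := ((hmem.filter_mono nhdsWithin_le_nhds).and
    (self_mem_nhdsWithin : Ioi (0 : ℝ) ∈ 𝓝[>] 0)).exists
  refine ⟨t, ht0, ?_⟩
  have : γ t ∈ ((↑) ⁻¹' D : Set (affineSpan ℝ D)) := interior_subset ht
  have h2 : ((γ t : affineSpan ℝ D) : X) = (y : X) - t • (d - y) := by
    simp only [γ, AffineMap.lineMap_apply_module]
    module
  rw [← h2]
  exact this

/-- Lagrange multipliers for a convex program with affine equality constraints, under a relative
interior constraint qualification. -/
theorem exists_lagrange_multiplier {X Z : Type*} [AddCommGroup X] [Module ℝ X]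
    [NormedAddCommGroup Z] [InnerProductSpace ℝ Z] [FiniteDimensional ℝ Z]
    {D : Set X} {g : X → ℝ} (hg : ConvexOn ℝ D g) (L : X →ₗ[ℝ] Z) (c : Z) (m : ℝ)
    (hmin : ∀ x ∈ D, L x = c → m ≤ g x) {x' : X} (hx' : x' ∈ D) (hLx' : L x' = c)
    (hri : ∀ d ∈ D, ∃ ε : ℝ, 0 < ε ∧ x' - ε • (d - x') ∈ D) :
    ∃ z : Z, ∀ x ∈ D, m ≤ g x + ⟪z, L x - c⟫_ℝ := by
  -- Conic combinations stay of the form t(Lx - c), with convex control of t(g x - m); this makes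
  -- the sets `V` and `S` below closed under addition.
  have comb : ∀ x ∈ D, ∀ y ∈ D, ∀ s t : ℝ, 0 ≤ s → 0 ≤ t → ∃ w ∈ D,
      (s + t) • (L w - c) = s • (L x - c) + t • (L y - c) ∧
        (s + t) * (g w - m) ≤ s * (g x - m) + t * (g y - m) := by
    intro x hx y hy s t hs ht
    rcases (add_nonneg hs ht).eq_or_lt with hst | hst
    · obtain rfl : s = 0 := by linarith
      obtain rfl : t = 0 := by linarith
      exact ⟨x, hx, by simp, by simp⟩
    have h1 : s / (s + t) + t / (s + t) = 1 := by field_simp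
    have hs' : 0 ≤ s / (s + t) := by positivity
    have ht' : 0 ≤ t / (s + t) := by positivity
    refine ⟨_, hg.1 hx hy hs' ht' h1, ?_, ?_⟩
    · rw [map_add, map_smul, map_smul, smul_sub, smul_add, smul_smul, smul_smul,
        mul_div_cancel₀ _ hst.ne', mul_div_cancel₀ _ hst.ne']
      module
    · have h := hg.2 hx hy hs' ht' h1
      have h2 := mul_le_mul_of_nonneg_left h hst.le
      have h3 : (s + t) * (s / (s + t) * g x + t / (s + t) * g y) = s * g x + t * g y := by
        field_simp
      simp only [smul_eq_mul] at h2
      rw [h3] at h2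
      linarith
  let V : Submodule ℝ Z :=
    { carrier := {v | ∃ t : ℝ, 0 ≤ t ∧ ∃ x ∈ D, v = t • (L x - c)}
      zero_mem' := ⟨1, zero_le_one, x', hx', by simp [hLx']⟩
      add_mem' := by
        rintro _ _ ⟨s, hs, x, hx, rfl⟩ ⟨t, ht, y, hy, rfl⟩
        obtain ⟨w, hw, h, -⟩ := comb x hx y hy s t hs ht
        exact ⟨s + t, add_nonneg hs ht, w, hw, h.symm⟩
      smul_mem' := by
        rintro a _ ⟨t, ht, x, hx, rfl⟩
        rcases lt_trichotomy a 0 with ha | ha | ha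
        -- The only use of the constraint qualification: reflecting through x' turns the cone
        -- generated by L(D) - c into a linear subspace.
        · obtain ⟨ε, hε, hd⟩ := hri x hx
          refine ⟨-a * t / ε, by have := neg_pos.2 ha; positivity, _, hd, ?_⟩
          have : L (x' - ε • (x - x')) - c = (-ε) • (L x - c) := by
            rw [map_sub, map_smul, map_sub, hLx']; module
          rw [this, smul_smul, smul_smul]
          congr 1
          field_simp
        · exact ⟨1, zero_le_one, x', hx', by simp [hLx', ha]⟩
        · exact ⟨a * t, mul_nonneg ha.le ht, x, hx, by rw [smul_smul]⟩ }
  let S : PointedCone ℝ (V × ℝ) :=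
    { carrier := {p | ∃ t : ℝ, 0 ≤ t ∧ ∃ x ∈ D, (p.1 : Z) = t • (L x - c) ∧
        t * (g x - m) ≤ p.2}
      zero_mem' := ⟨0, le_rfl, x', hx', by simp, by simp⟩
      smul_mem' := by
        rintro ⟨a, ha⟩ p ⟨t, ht, x, hx, h1, h2⟩
        refine ⟨a * t, mul_nonneg ha ht, x, hx, ?_, ?_⟩
        · simp [h1, smul_smul, Nonneg.mk_smul]
        · rw [mul_assoc]
          exact mul_le_mul_of_nonneg_left h2 ha
      add_mem' := by
        rintro p q ⟨s, hs, x, hx, h1, h2⟩ ⟨t, ht, y, hy, h3, h4⟩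
        obtain ⟨w, hw, h5, h6⟩ := comb x hx y hy s t hs ht
        refine ⟨s + t, add_nonneg hs ht, w, hw, ?_, ?_⟩
        · simp [h1, h3, h5]
        · simp only [Prod.snd_add]; linarith }
  -- The functional (0, a) ↦ a is nonnegative on `S` by optimality of `m`. An extension nonnegative
  -- on all of `S` is the multiplier; the Riesz theorem supplies it without any closedness of the
  -- cone.
  let f : (V × ℝ) →ₗ.[ℝ] ℝ :=
    { domain := LinearMap.ker (LinearMap.fst ℝ V ℝ)
      toFun := LinearMap.snd ℝ V ℝ ∘ₗ (LinearMap.ker (LinearMap.fst ℝ V ℝ)).subtype }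
  obtain ⟨φ, hφf, hφ⟩ := riesz_extension S f
    (by
      rintro ⟨⟨v, a⟩, hv⟩ ⟨t, ht, x, hx, h1, h2⟩
      change v = 0 at hv
      subst hv
      change 0 ≤ a
      refine le_trans ?_ h2
      have h3 : t • (L x - c) = 0 := by simpa using h1.symm
      rcases smul_eq_zero.1 h3 with h4 | h4
      · simp [h4]
      · exact mul_nonneg ht (sub_nonneg.2 (hmin x hx (sub_eq_zero.1 h4))))
    (by
      rintro ⟨⟨v, t, ht, x, hx, hv⟩, a⟩
      refine ⟨⟨(0, t * (g x - m) - a), by simp [f]⟩, t, ht, x, hx, ?_, ?_⟩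
      · simpa using hv
      · simp)
  -- The extension off `V` is arbitrary, since L x - c never leaves `V`.
  obtain ⟨ψ, hψ⟩ := LinearMap.exists_extend (φ ∘ₗ LinearMap.inl ℝ V ℝ)
  refine ⟨(InnerProductSpace.toDual ℝ Z).symm (LinearMap.toContinuousLinearMap ψ),
    fun x hx => ?_⟩
  rw [InnerProductSpace.toDual_symm_apply]
  have hv : L x - c ∈ V := ⟨1, zero_le_one, x, hx, by simp⟩
  have h1 := hφ (⟨L x - c, hv⟩, g x - m) ⟨1, zero_le_one, x, hx, by simp, by simp⟩
  have h2 : φ ((0 : V), g x - m) = g x - m := hφf ⟨(0, g x - m), by simp [f]⟩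
  have h3 : φ (⟨L x - c, hv⟩, (0 : ℝ)) = ψ (L x - c) := by
    have := LinearMap.congr_fun hψ ⟨L x - c, hv⟩
    simpa using this.symm
  have h4 : ((⟨L x - c, hv⟩ : V), g x - m) = ((⟨L x - c, hv⟩ : V), (0 : ℝ)) + (0, g x - m) := by
    simp
  rw [h4, map_add, h2, h3] at h1
  simp only [LinearMap.coe_toContinuousLinearMap']
  linarith

end Multiplier

/-! ### KKT points, primal and dual optimality -/

section Duality

variable {X₁ X₂ X₃ Z : Type*}
  [NormedAddCommGroup X₁] [InnerProductSpace ℝ X₁]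
  [NormedAddCommGroup X₂] [InnerProductSpace ℝ X₂]
  [NormedAddCommGroup X₃] [InnerProductSpace ℝ X₃]
  [NormedAddCommGroup Z] [InnerProductSpace ℝ Z]
  {P : Problem X₁ X₂ X₃ Z}

namespace Problem

theorem obj_eq_coe (hθ₁ : ClosedProperConvex P.θ₁) (hθ₂ : ClosedProperConvex P.θ₂)
    (hθ₃ : ClosedProperConvex P.θ₃) {x₁ : X₁} {x₂ : X₂} {x₃ : X₃} (h₁ : x₁ ∈ dom P.θ₁)
    (h₂ : x₂ ∈ dom P.θ₂) (h₃ : x₃ ∈ dom P.θ₃) :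
    P.obj x₁ x₂ x₃ =
      (((P.θ₁ x₁).toReal + (P.θ₂ x₂).toReal + (P.θ₃ x₃).toReal : ℝ) : EReal) := by
  rw [EReal.coe_add, EReal.coe_add, hθ₁.coe_toReal h₁, hθ₂.coe_toReal h₂, hθ₃.coe_toReal h₃,
    obj]

theorem mem_dom_of_obj_lt_top (hθ₁ : ClosedProperConvex P.θ₁) (hθ₂ : ClosedProperConvex P.θ₂)
    (hθ₃ : ClosedProperConvex P.θ₃) {x₁ : X₁} {x₂ : X₂} {x₃ : X₃}
    (h : P.obj x₁ x₂ x₃ < ⊤) : x₁ ∈ dom P.θ₁ ∧ x₂ ∈ dom P.θ₂ ∧ x₃ ∈ dom P.θ₃ := by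
  have n₁ := hθ₁.ne_bot x₁
  have n₂ := hθ₂.ne_bot x₂
  have n₃ := hθ₃.ne_bot x₃
  unfold obj at h
  have n₁₂ : P.θ₁ x₁ + P.θ₂ x₂ ≠ ⊥ := by simp [EReal.add_eq_bot_iff, n₁, n₂]
  have h3 : P.θ₃ x₃ ≠ ⊤ := by
    intro h'; rw [h', EReal.add_top_of_ne_bot n₁₂] at h; exact lt_irrefl _ h
  have h12 : P.θ₁ x₁ + P.θ₂ x₂ ≠ ⊤ := by
    intro h'; rw [h', EReal.top_add_of_ne_bot n₃] at h; exact lt_irrefl _ h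
  have h1 : P.θ₁ x₁ ≠ ⊤ := fun h' => h12 (by rw [h', EReal.top_add_of_ne_bot n₂])
  have h2 : P.θ₂ x₂ ≠ ⊤ := fun h' => h12 (by rw [h', EReal.add_top_of_ne_bot n₁])
  exact ⟨h1.lt_top, h2.lt_top, h3.lt_top⟩

variable [FiniteDimensional ℝ X₁] [FiniteDimensional ℝ X₂] [FiniteDimensional ℝ X₃]
  [FiniteDimensional ℝ Z]

theorem inner_residual_sub (P : Problem X₁ X₂ X₃ Z) (z : Z) (x₁ y₁ : X₁) (x₂ y₂ : X₂)
    (x₃ y₃ : X₃) :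
    ⟪z, P.residual y₁ y₂ y₃⟫_ℝ - ⟪z, P.residual x₁ x₂ x₃⟫_ℝ =
      ⟪P.A₁ z, y₁ - x₁⟫_ℝ + ⟪P.A₂ z, y₂ - x₂⟫_ℝ + ⟪P.A₃ z, y₃ - x₃⟫_ℝ := by
  rw [← LinearMap.adjoint_inner_right, ← LinearMap.adjoint_inner_right,
    ← LinearMap.adjoint_inner_right, ← inner_sub_right, ← inner_add_right, ← inner_add_right]
  congr 1
  simp only [residual, map_sub]
  abel

theorem IsKKT.mem_dom (hθ₁ : ClosedProperConvex P.θ₁) (hθ₂ : ClosedProperConvex P.θ₂)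
    (hθ₃ : ClosedProperConvex P.θ₃) {x₁ : X₁} {x₂ : X₂} {x₃ : X₃} {z : Z}
    (h : P.IsKKT x₁ x₂ x₃ z) : x₁ ∈ dom P.θ₁ ∧ x₂ ∈ dom P.θ₂ ∧ x₃ ∈ dom P.θ₃ :=
  ⟨hθ₁.mem_dom_of_mem_subdiff h.1, hθ₂.mem_dom_of_mem_subdiff h.2.1,
    hθ₃.mem_dom_of_mem_subdiff h.2.2.1⟩

/-- A KKT point minimizes the Lagrangian. -/
theorem IsKKT.obj_le_augLagrangian (hθ₁ : ClosedProperConvex P.θ₁)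
    (hθ₂ : ClosedProperConvex P.θ₂) (hθ₃ : ClosedProperConvex P.θ₃) {x₁ : X₁} {x₂ : X₂}
    {x₃ : X₃} {z : Z} (h : P.IsKKT x₁ x₂ x₃ z) (y₁ : X₁) (y₂ : X₂) (y₃ : X₃) :
    P.obj x₁ x₂ x₃ ≤ P.augLagrangian 0 y₁ y₂ y₃ z := by
  obtain ⟨h₁, h₂, h₃⟩ := h.mem_dom hθ₁ hθ₂ hθ₃
  unfold augLagrangian
  by_cases hy : P.obj y₁ y₂ y₃ < ⊤
  · obtain ⟨hy₁, hy₂, hy₃⟩ := mem_dom_of_obj_lt_top hθ₁ hθ₂ hθ₃ hy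
    rw [obj_eq_coe hθ₁ hθ₂ hθ₃ h₁ h₂ h₃, obj_eq_coe hθ₁ hθ₂ hθ₃ hy₁ hy₂ hy₃, ← EReal.coe_add,
      EReal.coe_le_coe_iff]
    have k₁ := (hθ₁.mem_subdiff_iff h₁).1 h.1 y₁ hy₁
    have k₂ := (hθ₂.mem_subdiff_iff h₂).1 h.2.1 y₂ hy₂
    have k₃ := (hθ₃.mem_subdiff_iff h₃).1 h.2.2.1 y₃ hy₃
    have e := P.inner_residual_sub z x₁ y₁ x₂ y₂ x₃ y₃
    rw [h.2.2.2, inner_zero_right] at e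
    rw [inner_neg_left] at k₁ k₂ k₃
    linarith
  · have : P.obj y₁ y₂ y₃ = ⊤ := by simpa using hy
    simp [this]

theorem IsKKT.isOptimal (hθ₁ : ClosedProperConvex P.θ₁) (hθ₂ : ClosedProperConvex P.θ₂)
    (hθ₃ : ClosedProperConvex P.θ₃) {x₁ : X₁} {x₂ : X₂} {x₃ : X₃} {z : Z}
    (h : P.IsKKT x₁ x₂ x₃ z) : P.IsOptimal x₁ x₂ x₃ := by
  obtain ⟨h₁, h₂, h₃⟩ := h.mem_dom hθ₁ hθ₂ hθ₃
  refine ⟨?_, h.2.2.2, fun y₁ y₂ y₃ hy => ?_⟩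
  · rw [obj_eq_coe hθ₁ hθ₂ hθ₃ h₁ h₂ h₃]; exact EReal.coe_lt_top _
  · simpa [augLagrangian, hy] using h.obj_le_augLagrangian hθ₁ hθ₂ hθ₃ y₁ y₂ y₃

/-- Weak duality, evaluated at the feasible KKT point, bounds every dual value by the primal one,
which in turn is at most the dual value at `z`. -/
theorem IsKKT.isDualOptimal (hθ₁ : ClosedProperConvex P.θ₁) (hθ₂ : ClosedProperConvex P.θ₂)
    (hθ₃ : ClosedProperConvex P.θ₃) {x₁ : X₁} {x₂ : X₂} {x₃ : X₃} {z : Z}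
    (h : P.IsKKT x₁ x₂ x₃ z) : P.IsDualOptimal z := by
  obtain ⟨h₁, h₂, h₃⟩ := h.mem_dom hθ₁ hθ₂ hθ₃
  have hle : P.obj x₁ x₂ x₃ ≤ P.dualObj z :=
    le_iInf fun y => h.obj_le_augLagrangian hθ₁ hθ₂ hθ₃ y.1 y.2.1 y.2.2
  refine ⟨lt_of_lt_of_le ?_ hle, fun z' => le_trans ?_ hle⟩
  · rw [obj_eq_coe hθ₁ hθ₂ hθ₃ h₁ h₂ h₃]; exact EReal.bot_lt_coe _
  · exact (iInf_le _ (x₁, x₂, x₃)).trans (by simp [augLagrangian, h.2.2.2])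

/-- With a multiplier, the optimal point minimizes the Lagrangian over the product domain; varying
one block at a time splits this into the three subgradient inclusions. -/
theorem IsOptimal.exists_isKKT (hθ₁ : ClosedProperConvex P.θ₁) (hθ₂ : ClosedProperConvex P.θ₂)
    (hθ₃ : ClosedProperConvex P.θ₃) (hCQ : P.ConstraintQualification) {x₁ : X₁} {x₂ : X₂}
    {x₃ : X₃} (h : P.IsOptimal x₁ x₂ x₃) : ∃ z, P.IsKKT x₁ x₂ x₃ z := by
  obtain ⟨h₁, h₂, h₃⟩ := mem_dom_of_obj_lt_top hθ₁ hθ₂ hθ₃ h.1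
  obtain ⟨x', hx', hr'⟩ := hCQ
  set D := dom P.θ₁ ×ˢ (dom P.θ₂ ×ˢ dom P.θ₃) with hD
  let g : X₁ × X₂ × X₃ → ℝ := fun x =>
    (P.θ₁ x.1).toReal + (P.θ₂ x.2.1).toReal + (P.θ₃ x.2.2).toReal
  have hDc : Convex ℝ D :=
    hθ₁.convexOn_toReal.1.prod (hθ₂.convexOn_toReal.1.prod hθ₃.convexOn_toReal.1)
  have hg : ConvexOn ℝ D g := by
    refine ⟨hDc, ?_⟩
    rintro x ⟨hx₁, hx₂, hx₃⟩ y ⟨hy₁, hy₂, hy₃⟩ a b ha hb hab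
    have k₁ := hθ₁.convexOn_toReal.2 hx₁ hy₁ ha hb hab
    have k₂ := hθ₂.convexOn_toReal.2 hx₂ hy₂ ha hb hab
    have k₃ := hθ₃.convexOn_toReal.2 hx₃ hy₃ ha hb hab
    simp only [g, smul_eq_mul, Prod.fst_add, Prod.smul_fst, Prod.snd_add, Prod.smul_snd] at *
    linarith
  let L : X₁ × X₂ × X₃ →ₗ[ℝ] Z :=
    P.A₁.adjoint.coprod (P.A₂.adjoint.coprod P.A₃.adjoint)
  have hL : ∀ x : X₁ × X₂ × X₃, L x - P.c = P.residual x.1 x.2.1 x.2.2 := by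
    intro x
    simp only [L, residual, LinearMap.coprod_apply]
    abel
  obtain ⟨z, hz⟩ := exists_lagrange_multiplier hg L P.c (g (x₁, x₂, x₃))
    (by
      rintro y ⟨hy₁, hy₂, hy₃⟩ hy
      have := h.2.2 y.1 y.2.1 y.2.2 (by rw [← hL, hy, sub_self])
      rw [obj_eq_coe hθ₁ hθ₂ hθ₃ h₁ h₂ h₃, obj_eq_coe hθ₁ hθ₂ hθ₃ hy₁ hy₂ hy₃,
        EReal.coe_le_coe_iff] at this
      exact this)
    (intrinsicInterior_subset hx') (sub_eq_zero.1 (by rw [hL, hr']))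
    (fun d hd => exists_pos_sub_smul_mem_of_mem_intrinsicInterior hx' hd)
  have key : ∀ y₁ ∈ dom P.θ₁, ∀ y₂ ∈ dom P.θ₂, ∀ y₃ ∈ dom P.θ₃,
      (P.θ₁ x₁).toReal + (P.θ₂ x₂).toReal + (P.θ₃ x₃).toReal ≤
        (P.θ₁ y₁).toReal + (P.θ₂ y₂).toReal + (P.θ₃ y₃).toReal +
          (⟪P.A₁ z, y₁ - x₁⟫_ℝ + ⟪P.A₂ z, y₂ - x₂⟫_ℝ + ⟪P.A₃ z, y₃ - x₃⟫_ℝ) := by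
    intro y₁ hy₁ y₂ hy₂ y₃ hy₃
    have := hz (y₁, y₂, y₃) ⟨hy₁, hy₂, hy₃⟩
    rw [hL] at this
    have e := P.inner_residual_sub z x₁ y₁ x₂ y₂ x₃ y₃
    rw [h.2.1, inner_zero_right, sub_zero] at e
    rw [← e]
    exact this
  refine ⟨z, (hθ₁.mem_subdiff_iff h₁).2 fun y hy => ?_,
    (hθ₂.mem_subdiff_iff h₂).2 fun y hy => ?_, (hθ₃.mem_subdiff_iff h₃).2 fun y hy => ?_, h.2.1⟩
  · have := key y hy x₂ h₂ x₃ h₃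
    simp only [sub_self, inner_zero_right, inner_neg_left] at this ⊢
    linarith
  · have := key x₁ h₁ y hy x₃ h₃
    simp only [sub_self, inner_zero_right, inner_neg_left] at this ⊢
    linarith
  · have := key x₁ h₁ x₂ h₂ y hy
    simp only [sub_self, inner_zero_right, inner_neg_left] at this ⊢
    linarith

end Problem

end Duality

/-! ### Optimality conditions of the ADMM subproblems -/

section Iteration

theorem sqNorm_add_smul {E : Type*} [NormedAddCommGroup E] [InnerProductSpace ℝ E]
    {T : E →ₗ[ℝ] E} (hT : T.IsSymmetric) (x y : E) (t : ℝ) :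
    sqNorm T (x + t • y) = sqNorm T x + 2 * t * ⟪T x, y⟫_ℝ + t ^ 2 * sqNorm T y := by
  have h1 : ⟪x, T y⟫_ℝ = ⟪T x, y⟫_ℝ := (hT x y).symm
  have h2 : ⟪y, T x⟫_ℝ = ⟪T x, y⟫_ℝ := real_inner_comm _ _
  simp only [sqNorm, map_add, map_smul, inner_add_left, inner_add_right, real_inner_smul_left,
    real_inner_smul_right, h1, h2]
  ring

theorem norm_add_smul_sq {E : Type*} [NormedAddCommGroup E] [InnerProductSpace ℝ E]
    (x y : E) (t : ℝ) : ‖x + t • y‖ ^ 2 = ‖x‖ ^ 2 + 2 * t * ⟪x, y⟫_ℝ + t ^ 2 * ‖y‖ ^ 2 := by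
  rw [norm_add_sq_real, real_inner_smul_right, norm_smul, mul_pow, Real.norm_eq_abs, sq_abs]
  ring

/-- Optimality condition for one block of the semi-proximal ADMM; `ρ` is the residual as a
function of the block. -/
theorem ClosedProperConvex.mem_subdiff_of_block_isMinOn {E Z : Type*}
    [NormedAddCommGroup E] [InnerProductSpace ℝ E] [FiniteDimensional ℝ E]
    [NormedAddCommGroup Z] [InnerProductSpace ℝ Z] [FiniteDimensional ℝ Z] {f : E → EReal}
    (hf : ClosedProperConvex f) {T : E →ₗ[ℝ] E} (hT : T.IsSymmetric) (A : Z →ₗ[ℝ] E)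
    {ρ : E → Z} (hρ : ∀ y y', ρ y' - ρ y = A.adjoint (y' - y)) (z : Z) (σ a : ℝ) {x x₀ : E}
    (hmin : IsMinOn (fun y => f y + ((a + (⟪z, ρ y⟫_ℝ + σ / 2 * ‖ρ y‖ ^ 2) +
      1 / 2 * sqNorm T (y - x₀) : ℝ) : EReal)) univ x) :
    -A (z + σ • ρ x) - T (x - x₀) ∈ subdiff f x := by
  have := hf.neg_mem_subdiff_of_isMinOn (g := A (z + σ • ρ x) + T (x - x₀))
    (C := fun y => σ / 2 * ‖A.adjoint (y - x)‖ ^ 2 + 1 / 2 * sqNorm T (y - x)) hmin ?_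
  · convert this using 1; abel
  · intro y t
    have e : ρ (x + t • (y - x)) = ρ x + t • A.adjoint (y - x) := by
      rw [← map_smul, ← sub_eq_iff_eq_add', hρ, add_sub_cancel_left]
    have e2 : x + t • (y - x) - x₀ = (x - x₀) + t • (y - x) := by abel
    rw [e, e2, sqNorm_add_smul hT, norm_add_smul_sq, inner_add_left,
      ← LinearMap.adjoint_inner_right A, inner_add_left, real_inner_smul_left, inner_add_right,
      real_inner_smul_right]
    ring

variable {X₁ X₂ X₃ Z : Type*}
  [NormedAddCommGroup X₁] [InnerProductSpace ℝ X₁] [FiniteDimensional ℝ X₁]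
  [NormedAddCommGroup X₂] [InnerProductSpace ℝ X₂] [FiniteDimensional ℝ X₂]
  [NormedAddCommGroup X₃] [InnerProductSpace ℝ X₃] [FiniteDimensional ℝ X₃]
  [NormedAddCommGroup Z] [InnerProductSpace ℝ Z] [FiniteDimensional ℝ Z]
  {P : Problem X₁ X₂ X₃ Z} {Q : Params X₁ X₂ X₃} {s : Iterates X₁ X₂ X₃ Z}

/-- Once the fixed blocks have finite values, a subproblem is θᵢ plus a real-valued function, the
form to which the first order condition applies. -/
theorem augLagrangian_add_eq_block₁ (hθ₂ : ClosedProperConvex P.θ₂)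
    (hθ₃ : ClosedProperConvex P.θ₃) {x₂ : X₂} {x₃ : X₃} (h₂ : x₂ ∈ dom P.θ₂)
    (h₃ : x₃ ∈ dom P.θ₃) (σ : ℝ) (z : Z) (q : X₁ → ℝ) :
    (fun y => P.augLagrangian σ y x₂ x₃ z + (q y : EReal)) = fun y => P.θ₁ y +
      (((P.θ₂ x₂).toReal + (P.θ₃ x₃).toReal + (⟪z, P.residual y x₂ x₃⟫_ℝ +
        σ / 2 * ‖P.residual y x₂ x₃‖ ^ 2) + q y : ℝ) : EReal) := by
  funext y
  rw [Problem.augLagrangian, Problem.obj, ← hθ₂.coe_toReal h₂, ← hθ₃.coe_toReal h₃,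
    EReal.toReal_coe, EReal.toReal_coe, EReal.coe_add _ (q y), EReal.coe_add _ (_ + _),
    EReal.coe_add (P.θ₂ x₂).toReal]
  ac_rfl

theorem augLagrangian_add_eq_block₂ (hθ₁ : ClosedProperConvex P.θ₁)
    (hθ₃ : ClosedProperConvex P.θ₃) {x₁ : X₁} {x₃ : X₃} (h₁ : x₁ ∈ dom P.θ₁)
    (h₃ : x₃ ∈ dom P.θ₃) (σ : ℝ) (z : Z) (q : X₂ → ℝ) :
    (fun y => P.augLagrangian σ x₁ y x₃ z + (q y : EReal)) = fun y => P.θ₂ y +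
      (((P.θ₁ x₁).toReal + (P.θ₃ x₃).toReal + (⟪z, P.residual x₁ y x₃⟫_ℝ +
        σ / 2 * ‖P.residual x₁ y x₃‖ ^ 2) + q y : ℝ) : EReal) := by
  funext y
  rw [Problem.augLagrangian, Problem.obj, ← hθ₁.coe_toReal h₁, ← hθ₃.coe_toReal h₃,
    EReal.toReal_coe, EReal.toReal_coe, EReal.coe_add _ (q y), EReal.coe_add _ (_ + _),
    EReal.coe_add (P.θ₁ x₁).toReal]
  ac_rfl

theorem augLagrangian_add_eq_block₃ (hθ₁ : ClosedProperConvex P.θ₁)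
    (hθ₂ : ClosedProperConvex P.θ₂) {x₁ : X₁} {x₂ : X₂} (h₁ : x₁ ∈ dom P.θ₁)
    (h₂ : x₂ ∈ dom P.θ₂) (σ : ℝ) (z : Z) (q : X₃ → ℝ) :
    (fun y => P.augLagrangian σ x₁ x₂ y z + (q y : EReal)) = fun y => P.θ₃ y +
      (((P.θ₁ x₁).toReal + (P.θ₂ x₂).toReal + (⟪z, P.residual x₁ x₂ y⟫_ℝ +
        σ / 2 * ‖P.residual x₁ x₂ y‖ ^ 2) + q y : ℝ) : EReal) := by
  funext y
  rw [Problem.augLagrangian, Problem.obj, ← hθ₁.coe_toReal h₁, ← hθ₂.coe_toReal h₂,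
    EReal.toReal_coe, EReal.toReal_coe, EReal.coe_add _ (q y), EReal.coe_add _ (_ + _),
    EReal.coe_add (P.θ₁ x₁).toReal]
  ac_rfl

/-- Finiteness propagates from block to block: a subproblem with finite fixed blocks has a finite
value somewhere, so its minimizer lies in the domain. -/
theorem IsGenerated.mem_dom (hs : IsGenerated P Q s) (hθ₁ : ClosedProperConvex P.θ₁)
    (hθ₂ : ClosedProperConvex P.θ₂) (hθ₃ : ClosedProperConvex P.θ₃) (k : ℕ) :
    s.x₁ k ∈ dom P.θ₁ ∧ s.x₂ k ∈ dom P.θ₂ ∧ s.x₃ k ∈ dom P.θ₃ := by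
  induction k with
  | zero => exact ⟨hs.init₁, hs.init₂, hs.init₃⟩
  | succ k ih =>
    have h₁ := hs.step₁ k
    rw [augLagrangian_add_eq_block₁ hθ₂ hθ₃ ih.2.1 ih.2.2] at h₁
    have m₁ := hθ₁.mem_dom_of_isMinOn h₁
    have h₂ := hs.step₂ k
    rw [augLagrangian_add_eq_block₂ hθ₁ hθ₃ m₁ ih.2.2] at h₂
    have m₂ := hθ₂.mem_dom_of_isMinOn h₂
    have h₃ := hs.step₃ k
    rw [augLagrangian_add_eq_block₃ hθ₁ hθ₂ m₁ m₂] at h₃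
    exact ⟨m₁, m₂, hθ₃.mem_dom_of_isMinOn h₃⟩

/-- Block 1 sees the residual at the old x₂ and x₃; expressing it through r^{k+1} exhibits the lag
A₂*Δx₂ + A₃*Δx₃. -/
theorem IsGenerated.mem_subdiff₁ (hs : IsGenerated P Q s) (hθ₁ : ClosedProperConvex P.θ₁)
    (hθ₂ : ClosedProperConvex P.θ₂) (hθ₃ : ClosedProperConvex P.θ₃) (hT₁ : Q.T₁.IsSymmetric)
    (k : ℕ) :
    -P.A₁ (s.z k + Q.σ • (res P s (k + 1) - P.A₂.adjoint (incr s.x₂ k) -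
      P.A₃.adjoint (incr s.x₃ k))) - Q.T₁ (incr s.x₁ k) ∈ subdiff P.θ₁ (s.x₁ (k + 1)) := by
  obtain ⟨m₁, m₂, m₃⟩ := hs.mem_dom hθ₁ hθ₂ hθ₃ k
  have h := hs.step₁ k
  rw [augLagrangian_add_eq_block₁ hθ₂ hθ₃ m₂ m₃] at h
  have := hθ₁.mem_subdiff_of_block_isMinOn hT₁ P.A₁
    (by intro y y'; simp only [Problem.residual, map_sub]; abel) _ _ _ h
  have e : P.residual (s.x₁ (k + 1)) (s.x₂ k) (s.x₃ k) = res P s (k + 1) -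
      P.A₂.adjoint (incr s.x₂ k) - P.A₃.adjoint (incr s.x₃ k) := by
    simp only [res, Problem.residual, incr, map_sub]
    abel
  rwa [e] at this

theorem IsGenerated.mem_subdiff₂ (hs : IsGenerated P Q s) (hθ₁ : ClosedProperConvex P.θ₁)
    (hθ₂ : ClosedProperConvex P.θ₂) (hθ₃ : ClosedProperConvex P.θ₃) (hT₂ : Q.T₂.IsSymmetric)
    (k : ℕ) :
    -P.A₂ (s.z k + Q.σ • (res P s (k + 1) - P.A₃.adjoint (incr s.x₃ k))) -
      Q.T₂ (incr s.x₂ k) ∈ subdiff P.θ₂ (s.x₂ (k + 1)) := by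
  obtain ⟨m₁, m₂, m₃⟩ := hs.mem_dom hθ₁ hθ₂ hθ₃ k
  obtain ⟨n₁, n₂, n₃⟩ := hs.mem_dom hθ₁ hθ₂ hθ₃ (k + 1)
  have h := hs.step₂ k
  rw [augLagrangian_add_eq_block₂ hθ₁ hθ₃ n₁ m₃] at h
  have := hθ₂.mem_subdiff_of_block_isMinOn hT₂ P.A₂
    (by intro y y'; simp only [Problem.residual, map_sub]; abel) _ _ _ h
  have e : P.residual (s.x₁ (k + 1)) (s.x₂ (k + 1)) (s.x₃ k) = res P s (k + 1) -
      P.A₃.adjoint (incr s.x₃ k) := by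
    simp only [res, Problem.residual, incr, map_sub]
    abel
  rwa [e] at this

theorem IsGenerated.mem_subdiff₃ (hs : IsGenerated P Q s) (hθ₁ : ClosedProperConvex P.θ₁)
    (hθ₂ : ClosedProperConvex P.θ₂) (hθ₃ : ClosedProperConvex P.θ₃) (hT₃ : Q.T₃.IsSymmetric)
    (k : ℕ) :
    -P.A₃ (s.z k + Q.σ • res P s (k + 1)) - Q.T₃ (incr s.x₃ k) ∈
      subdiff P.θ₃ (s.x₃ (k + 1)) := by
  obtain ⟨n₁, n₂, n₃⟩ := hs.mem_dom hθ₁ hθ₂ hθ₃ (k + 1)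
  have h := hs.step₃ k
  rw [augLagrangian_add_eq_block₃ hθ₁ hθ₂ n₁ n₂] at h
  exact hθ₃.mem_subdiff_of_block_isMinOn hT₃ P.A₃
    (by intro y y'; simp only [Problem.residual, map_sub]; abel) _ _ _ h

end Iteration

/-! ### Quadratic forms and Young's inequality -/

section SqNorm

variable {E F : Type*} [NormedAddCommGroup E] [InnerProductSpace ℝ E]
  [NormedAddCommGroup F] [InnerProductSpace ℝ F]

theorem sqNorm_add_op (G G' : E →ₗ[ℝ] E) (x : E) :
    sqNorm (G + G') x = sqNorm G x + sqNorm G' x := by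
  simp [sqNorm, inner_add_right]

theorem sqNorm_sub_op (G G' : E →ₗ[ℝ] E) (x : E) :
    sqNorm (G - G') x = sqNorm G x - sqNorm G' x := by
  simp [sqNorm, inner_sub_right]

theorem sqNorm_smul_op (a : ℝ) (G : E →ₗ[ℝ] E) (x : E) :
    sqNorm (a • G) x = a * sqNorm G x := by
  simp [sqNorm, real_inner_smul_right]

theorem sqNorm_comp_adjoint [FiniteDimensional ℝ E] [FiniteDimensional ℝ F] (A : F →ₗ[ℝ] E)
    (x : E) : sqNorm (A ∘ₗ A.adjoint) x = ‖A.adjoint x‖ ^ 2 := by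
  rw [sqNorm, LinearMap.comp_apply, ← LinearMap.adjoint_inner_left, real_inner_self_eq_norm_sq]

theorem sqNorm_blockDiag (P : E →ₗ[ℝ] E) (Q : F →ₗ[ℝ] F) (x : E) (y : F) :
    sqNorm (blockDiag P Q) (WithLp.toLp 2 (x, y)) = sqNorm P x + sqNorm Q y := by
  simp [sqNorm, blockDiag, WithLp.prod_inner_apply]

theorem sqNorm_nonneg {G : E →ₗ[ℝ] E} (hG : G.IsPositive) (x : E) : 0 ≤ sqNorm G x := by
  simpa [sqNorm, real_inner_comm] using hG.2 x

theorem PosDef.isPositive {G : E →ₗ[ℝ] E} (hG : PosDef G) : G.IsPositive := by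
  refine ⟨hG.1, fun x => ?_⟩
  rcases eq_or_ne x 0 with rfl | hx
  · simp
  · simpa [sqNorm, real_inner_comm] using (hG.2 x hx).le

theorem PosDef.sqNorm_nonneg {G : E →ₗ[ℝ] E} (hG : PosDef G) (x : E) : 0 ≤ sqNorm G x :=
  SPADMM.sqNorm_nonneg hG.isPositive x

theorem sqNorm_sub {T : E →ₗ[ℝ] E} (hT : T.IsSymmetric) (x y : E) :
    sqNorm T (x - y) = sqNorm T x - 2 * ⟪x, T y⟫_ℝ + sqNorm T y := by
  have := sqNorm_add_smul hT x y (-1)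
  rw [neg_one_smul, ← sub_eq_add_neg, hT x y] at this
  rw [this]; ring

/-- The difference of the two sides is half the form at 2x - y. -/
theorem sqNorm_half_le {S : E →ₗ[ℝ] E} (hS : S.IsPositive) (x y : E) :
    1 / 2 * sqNorm S y ≤ sqNorm S x + sqNorm S (x - y) := by
  have h := sqNorm_nonneg hS (2 • x - y)
  have h1 : sqNorm S (2 • x - y) = 4 * sqNorm S x - 4 * ⟪x, S y⟫_ℝ + sqNorm S y := by
    rw [sqNorm_sub hS.1, two_smul]
    simp only [sqNorm, map_add, inner_add_left, inner_add_right]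
    ring
  rw [sqNorm_sub hS.1]
  linarith

/-- Three point estimate for one block. -/
theorem block_three_point {S T : E →ₗ[ℝ] E} (hS : S.IsPositive) (hT : T.IsSymmetric) (x y : E) :
    sqNorm S x + sqNorm T x + (1 / 2 * sqNorm S y + sqNorm T y) ≤
      2 * sqNorm S x + 2 * ⟪x, T y⟫_ℝ + (sqNorm S (x - y) + sqNorm T (x - y)) := by
  have h1 := sqNorm_half_le hS x y
  have h2 := sqNorm_sub hT x y
  linarith

theorem sqNorm_sub_le_inner {T : E →ₗ[ℝ] E} (hT : T.IsPositive) (x y : E) :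
    sqNorm T x - sqNorm T y ≤ 2 * ⟪x, T (x - y)⟫_ℝ := by
  have h1 := sqNorm_sub hT.1 x y
  have h2 := sqNorm_nonneg hT (x - y)
  have h3 : ⟪x, T (x - y)⟫_ℝ = sqNorm T x - ⟪x, T y⟫_ℝ := by
    rw [map_sub, inner_sub_right, sqNorm]
  linarith

variable [FiniteDimensional ℝ E]

theorem PosDef.apply_inverse {S : E →ₗ[ℝ] E} (hS : PosDef S) (v : E) :
    S ((Ring.inverse S : E →ₗ[ℝ] E) v) = v := by
  have hk : LinearMap.ker S = ⊥ := by
    refine LinearMap.ker_eq_bot'.2 fun x hx => ?_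
    by_contra h
    have := hS.2 x h
    simp [sqNorm, hx] at this
  have hu : IsUnit S := LinearMap.isUnit_iff_ker_eq_bot S |>.2 hk
  have := Ring.mul_inverse_cancel S hu
  exact LinearMap.congr_fun this v

theorem PosDef.sqNorm_inverse {S : E →ₗ[ℝ] E} (hS : PosDef S) (v : E) :
    sqNorm (Ring.inverse S : E →ₗ[ℝ] E) v =
      sqNorm S ((Ring.inverse S : E →ₗ[ℝ] E) v) := by
  rw [sqNorm, sqNorm, hS.apply_inverse, real_inner_comm]

/-- Young's inequality for the norms of `S` and `S⁻¹`. -/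
theorem PosDef.two_mul_inner_le {S : E →ₗ[ℝ] E} (hS : PosDef S) (x v : E) {β : ℝ} (hβ : 0 < β) :
    2 * ⟪x, v⟫_ℝ ≤ β * sqNorm S x + β⁻¹ * sqNorm (Ring.inverse S : E →ₗ[ℝ] E) v := by
  have h := hS.sqNorm_nonneg (β • x - (Ring.inverse S : E →ₗ[ℝ] E) v)
  rw [sqNorm_sub hS.1, hS.apply_inverse, ← hS.sqNorm_inverse, real_inner_smul_left] at h
  have h1 : sqNorm S (β • x) = β * (β * sqNorm S x) := by
    simp only [sqNorm, map_smul, real_inner_smul_left, real_inner_smul_right]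
  rw [h1] at h
  have h2 := mul_nonneg (inv_nonneg.2 hβ.le) h
  have h3 : β⁻¹ * (β * (β * sqNorm S x) - 2 * (β * ⟪x, v⟫_ℝ) +
      sqNorm (Ring.inverse S : E →ₗ[ℝ] E) v) = β * sqNorm S x - 2 * ⟪x, v⟫_ℝ +
      β⁻¹ * sqNorm (Ring.inverse S : E →ₗ[ℝ] E) v := by
    field_simp
  linarith

end SqNorm

/-! ### The descent inequality -/

section Descent

variable {X₁ X₂ X₃ Z : Type*}
  [NormedAddCommGroup X₁] [InnerProductSpace ℝ X₁] [FiniteDimensional ℝ X₁]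
  [NormedAddCommGroup X₂] [InnerProductSpace ℝ X₂] [FiniteDimensional ℝ X₂]
  [NormedAddCommGroup X₃] [InnerProductSpace ℝ X₃] [FiniteDimensional ℝ X₃]
  [NormedAddCommGroup Z] [InnerProductSpace ℝ Z] [FiniteDimensional ℝ Z]
  {P : Problem X₁ X₂ X₃ Z} {Q : Params X₁ X₂ X₃} {s : Iterates X₁ X₂ X₃ Z}

theorem sqNorm_comp_B_adjoint (x₂ : X₂) (x₃ : X₃) :
    sqNorm (P.B ∘ₗ P.B.adjoint) (WithLp.toLp 2 (x₂, x₃)) =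
      ‖P.A₂.adjoint x₂ + P.A₃.adjoint x₃‖ ^ 2 := by
  rw [sqNorm_comp_adjoint]
  congr 2
  refine ext_inner_right ℝ fun z => ?_
  rw [LinearMap.adjoint_inner_left, inner_add_left, LinearMap.adjoint_inner_left,
    LinearMap.adjoint_inner_left]
  simp [Problem.B, WithLp.prod_inner_apply]

theorem sqNorm_opM (α : ℝ) (x₂ : X₂) (x₃ : X₃) :
    sqNorm (opM P Q α) (WithLp.toLp 2 (x₂, x₃)) =
      (1 - α) * sqNorm Q.S₂ x₂ + sqNorm Q.T₂ x₂ + (sqNorm Q.S₃ x₃ + sqNorm Q.T₃ x₃) +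
        Q.σ * ‖P.A₂.adjoint x₂ + P.A₃.adjoint x₃‖ ^ 2 := by
  rw [opM, sqNorm_add_op, sqNorm_blockDiag, sqNorm_smul_op, sqNorm_comp_B_adjoint,
    sqNorm_add_op, sqNorm_add_op, sqNorm_smul_op]

theorem sqNorm_opH (α : ℝ) (x₂ : X₂) (x₃ : X₃) :
    sqNorm (opH P Q α) (WithLp.toLp 2 (x₂, x₃)) =
      5 * (1 - α) / 2 * sqNorm Q.S₂ x₂ + sqNorm Q.T₂ x₂ +
        (5 / 2 * sqNorm Q.S₃ x₃ + sqNorm Q.T₃ x₃ -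
          5 * Q.σ ^ 2 / (2 * α) * sqNorm (crossOp P Q) x₃) +
        min Q.τ (1 + Q.τ - Q.τ ^ 2) * Q.σ * ‖P.A₂.adjoint x₂ + P.A₃.adjoint x₃‖ ^ 2 := by
  rw [opH, sqNorm_add_op, sqNorm_blockDiag, sqNorm_smul_op, sqNorm_comp_B_adjoint,
    sqNorm_add_op, sqNorm_smul_op, sqNorm_sub_op, sqNorm_add_op, sqNorm_smul_op,
    sqNorm_smul_op]

theorem sqNorm_crossOp (x : X₃) :
    sqNorm (crossOp P Q) x =
      sqNorm (Ring.inverse Q.S₂ : X₂ →ₗ[ℝ] X₂) (P.A₂ (P.A₃.adjoint x)) := by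
  rw [sqNorm, crossOp, LinearMap.comp_apply, LinearMap.adjoint_inner_right]
  rfl

theorem sqNorm_crossOp_nonneg (hS₂ : PosDef Q.S₂) (x : X₃) : 0 ≤ sqNorm (crossOp P Q) x := by
  rw [sqNorm_crossOp, hS₂.sqNorm_inverse]
  exact hS₂.sqNorm_nonneg _

theorem sqNorm_crossOp_neg (x : X₃) : sqNorm (crossOp P Q) (-x) = sqNorm (crossOp P Q) x := by
  simp [sqNorm]

/-- Bound for the coupling of the second and third block. -/
theorem two_mul_inner_adjoint_le (hS₂ : PosDef Q.S₂) (hσ : 0 < Q.σ) (x₂ : X₂) (x₃ : X₃) {β : ℝ}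
    (hβ : 0 < β) :
    2 * Q.σ * ⟪P.A₂.adjoint x₂, P.A₃.adjoint x₃⟫_ℝ ≤
      β * sqNorm Q.S₂ x₂ + Q.σ ^ 2 / β * sqNorm (crossOp P Q) x₃ := by
  have h := hS₂.two_mul_inner_le x₂ (P.A₂ (P.A₃.adjoint x₃)) (div_pos hβ hσ)
  rw [← sqNorm_crossOp, ← LinearMap.adjoint_inner_left] at h
  have h2 := mul_le_mul_of_nonneg_left h hσ.le
  have h3 : Q.σ * (β / Q.σ * sqNorm Q.S₂ x₂ + (β / Q.σ)⁻¹ * sqNorm (crossOp P Q) x₃) =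
      β * sqNorm Q.S₂ x₂ + Q.σ ^ 2 / β * sqNorm (crossOp P Q) x₃ := by
    field_simp
  rw [h3] at h2
  linarith

theorem inner_neg_sub_sub_neg {E : Type*} [NormedAddCommGroup E] [InnerProductSpace ℝ E]
    [FiniteDimensional ℝ E] (A : Z →ₗ[ℝ] E) (e t : E) (u v : Z) :
    ⟪e, -A u - t - -A v⟫_ℝ = -⟪A.adjoint e, u - v⟫_ℝ - ⟪e, t⟫_ℝ := by
  rw [LinearMap.adjoint_inner_left, map_sub]
  simp only [inner_sub_right, inner_neg_right]
  ring

/-- Used with aᵢ = Aᵢ*(xᵢ^{k+1} - x̄ᵢ), bᵢ = Aᵢ*Δxᵢ^k and ζ = z^k - z̄. Eliminating a₁ pairs ζ with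
r alone, which the multiplier update turns into a difference of squares; the last term is the one
peculiar to three blocks. -/
theorem inner_residual_identity {a₁ a₂ a₃ b₂ b₃ r ζ : Z} (hr : a₁ + a₂ + a₃ = r) (σ τ : ℝ)
    (hσ : σ ≠ 0) (hτ : τ ≠ 0) :
    -2 * ⟪a₁, ζ + σ • (r - b₂ - b₃)⟫_ℝ - 2 * ⟪a₂, ζ + σ • (r - b₃)⟫_ℝ -
        2 * ⟪a₃, ζ + σ • r⟫_ℝ =
      (σ * τ)⁻¹ * ‖ζ‖ ^ 2 - (σ * τ)⁻¹ * ‖ζ + (τ * σ) • r‖ ^ 2 +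
        (σ * ‖a₂ + a₃ - (b₂ + b₃)‖ ^ 2 - σ * ‖a₂ + a₃‖ ^ 2) - (2 - τ) * σ * ‖r‖ ^ 2 +
        2 * σ * ⟪r, b₂ + b₃⟫_ℝ - σ * ‖b₂ + b₃‖ ^ 2 + 2 * σ * ⟪a₂, b₃⟫_ℝ := by
  obtain rfl : a₁ = r - a₂ - a₃ := by rw [← hr]; abel
  rw [norm_add_smul_sq, norm_sub_sq_real]
  have e1 : (σ * τ)⁻¹ * (‖ζ‖ ^ 2 + 2 * (τ * σ) * ⟪ζ, r⟫_ℝ + (τ * σ) ^ 2 * ‖r‖ ^ 2) =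
      (σ * τ)⁻¹ * ‖ζ‖ ^ 2 + 2 * ⟪r, ζ⟫_ℝ + τ * σ * ‖r‖ ^ 2 := by
    rw [real_inner_comm ζ r]; field_simp
  rw [e1, ← real_inner_self_eq_norm_sq r]
  simp only [inner_add_right, inner_sub_right, inner_add_left, inner_sub_left,
    real_inner_smul_right]
  ring

theorem residual_sub_residual (x₁ y₁ : X₁) (x₂ y₂ : X₂) (x₃ y₃ : X₃)
    (hy : P.residual y₁ y₂ y₃ = 0) :
    P.A₁.adjoint (x₁ - y₁) + P.A₂.adjoint (x₂ - y₂) + P.A₃.adjoint (x₃ - y₃) =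
      P.residual x₁ x₂ x₃ := by
  rw [← sub_zero (P.residual x₁ x₂ x₃), ← hy]
  simp only [Problem.residual, map_sub]
  abel

theorem IsGenerated.phi_sub_phi_ge (hs : IsGenerated P Q s) (hθ₁ : ClosedProperConvex P.θ₁)
    (hθ₂ : ClosedProperConvex P.θ₂) (hθ₃ : ClosedProperConvex P.θ₃)
    (hS₁ : Q.S₁.IsPositive) (hS₂ : PosDef Q.S₂) (hS₃ : Q.S₃.IsPositive)
    (hmono₁ : MonotoneWith P.θ₁ Q.S₁) (hmono₂ : MonotoneWith P.θ₂ Q.S₂)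
    (hmono₃ : MonotoneWith P.θ₃ Q.S₃) (hσ : 0 < Q.σ) (hτ : 0 < Q.τ)
    (hT₁ : Q.T₁.IsPositive) (hT₂ : Q.T₂.IsPositive) (hT₃ : Q.T₃.IsPositive) {α : ℝ}
    (hα : 0 < α) (hα1 : α ≤ 1) {x₁ : X₁} {x₂ : X₂} {x₃ : X₃} {z : Z} (h : P.IsKKT x₁ x₂ x₃ z)
    (k : ℕ) :
    (2 - Q.τ) * Q.σ * ‖res P s (k + 1)‖ ^ 2 -
      2 * Q.σ * ⟪res P s (k + 1), P.A₂.adjoint (incr s.x₂ k) + P.A₃.adjoint (incr s.x₃ k)⟫_ℝ +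
      Q.σ * ‖P.A₂.adjoint (incr s.x₂ k) + P.A₃.adjoint (incr s.x₃ k)‖ ^ 2 +
      (1 / 2 * sqNorm Q.S₁ (incr s.x₁ k) + sqNorm Q.T₁ (incr s.x₁ k)) +
      ((1 - α) / 2 * sqNorm Q.S₂ (incr s.x₂ k) + sqNorm Q.T₂ (incr s.x₂ k)) +
      (1 / 2 * sqNorm Q.S₃ (incr s.x₃ k) + sqNorm Q.T₃ (incr s.x₃ k)) -
      Q.σ ^ 2 / (2 * α) * sqNorm (crossOp P Q) (incr s.x₃ k) ≤
    phi P Q α s x₁ x₂ x₃ z k - phi P Q α s x₁ x₂ x₃ z (k + 1) := by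
  obtain ⟨m₁, m₂, m₃⟩ := h.mem_dom hθ₁ hθ₂ hθ₃
  obtain ⟨n₁, n₂, n₃⟩ := hs.mem_dom hθ₁ hθ₂ hθ₃ (k + 1)
  have k₁ := hmono₁ _ n₁ _ m₁ _ (hs.mem_subdiff₁ hθ₁ hθ₂ hθ₃ hT₁.1 k) _ h.1
  have k₂ := hmono₂ _ n₂ _ m₂ _ (hs.mem_subdiff₂ hθ₁ hθ₂ hθ₃ hT₂.1 k) _ h.2.1
  have k₃ := hmono₃ _ n₃ _ m₃ _ (hs.mem_subdiff₃ hθ₁ hθ₂ hθ₃ hT₃.1 k) _ h.2.2.1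
  rw [inner_neg_sub_sub_neg, add_sub_right_comm] at k₁ k₂ k₃
  have hr := residual_sub_residual (s.x₁ (k + 1)) x₁ (s.x₂ (k + 1)) x₂ (s.x₃ (k + 1)) x₃ h.2.2.2
  change _ = res P s (k + 1) at hr
  have hz : s.z (k + 1) - z = s.z k - z + (Q.τ * Q.σ) • res P s (k + 1) := by
    rw [hs.stepz k, res]; abel
  have d₁ : s.x₁ k - x₁ = s.x₁ (k + 1) - x₁ - incr s.x₁ k := by rw [incr]; abel
  have d₂ : s.x₂ k - x₂ = s.x₂ (k + 1) - x₂ - incr s.x₂ k := by rw [incr]; abel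
  have d₃ : s.x₃ k - x₃ = s.x₃ (k + 1) - x₃ - incr s.x₃ k := by rw [incr]; abel
  have dB : P.A₂.adjoint (s.x₂ k - x₂) + P.A₃.adjoint (s.x₃ k - x₃) =
      P.A₂.adjoint (s.x₂ (k + 1) - x₂) + P.A₃.adjoint (s.x₃ (k + 1) - x₃) -
        (P.A₂.adjoint (incr s.x₂ k) + P.A₃.adjoint (incr s.x₃ k)) := by
    rw [d₂, d₃, map_sub _ (s.x₂ (k + 1) - x₂), map_sub _ (s.x₃ (k + 1) - x₃)]; abel
  have hid := inner_residual_identity (b₂ := P.A₂.adjoint (incr s.x₂ k))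
    (b₃ := P.A₃.adjoint (incr s.x₃ k)) (ζ := s.z k - z) hr Q.σ Q.τ hσ.ne' hτ.ne'
  -- With β = 2α the Young bound consumes 2α of the available 2‖x₂^{k+1} - x̄₂‖² in the Σ₂ norm. The
  -- rest is the three point estimate for (1-α)Σ₂.
  have hy := two_mul_inner_adjoint_le (P := P) hS₂ hσ (s.x₂ (k + 1) - x₂) (incr s.x₃ k)
    (mul_pos two_pos hα)
  have q₁ := block_three_point hS₁ hT₁.1 (s.x₁ (k + 1) - x₁) (incr s.x₁ k)
  have q₂ := block_three_point ((LinearMap.IsPositive.smul_of_nonneg hS₂.isPositive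
    (sub_nonneg.2 hα1))) hT₂.1 (s.x₂ (k + 1) - x₂) (incr s.x₂ k)
  have q₃ := block_three_point hS₃ hT₃.1 (s.x₃ (k + 1) - x₃) (incr s.x₃ k)
  simp only [sqNorm_smul_op] at q₂
  simp only [phi, sqNorm_opM, sqNorm_add_op]
  rw [hz, dB, d₁, d₂, d₃]
  linarith

theorem inner_neg_sub_sub_neg_sub {E : Type*} [NormedAddCommGroup E] [InnerProductSpace ℝ E]
    [FiniteDimensional ℝ E] (A : Z →ₗ[ℝ] E) (e t t' : E) (u v : Z) :
    ⟪e, -A u - t - (-A v - t')⟫_ℝ = -⟪A.adjoint e, u - v⟫_ℝ - ⟪e, t - t'⟫_ℝ := by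
  rw [LinearMap.adjoint_inner_left, map_sub]
  simp only [inner_sub_right, inner_neg_right]
  ring

/-- Monotonicity is applied between the subgradients of two consecutive steps. The update of z
contributes τσr^{k+1}, whence the factor 1-τ. -/
theorem IsGenerated.inner_res_incr_le (hs : IsGenerated P Q s) (hθ₁ : ClosedProperConvex P.θ₁)
    (hθ₂ : ClosedProperConvex P.θ₂) (hθ₃ : ClosedProperConvex P.θ₃)
    (hS₂ : PosDef Q.S₂) (hmono₂ : MonotoneWith P.θ₂ Q.S₂)
    (hmono₃ : MonotoneWith P.θ₃ Q.S₃) (hσ : 0 < Q.σ)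
    (hT₂ : Q.T₂.IsPositive) (hT₃ : Q.T₃.IsPositive) {α : ℝ} (hα : 0 < α) (k : ℕ) :
    2 * Q.σ * ⟪res P s (k + 1 + 1),
        P.A₂.adjoint (incr s.x₂ (k + 1)) + P.A₃.adjoint (incr s.x₃ (k + 1))⟫_ℝ +
      (sqNorm Q.T₂ (incr s.x₂ (k + 1)) - sqNorm Q.T₂ (incr s.x₂ k)) +
      (sqNorm Q.T₃ (incr s.x₃ (k + 1)) - sqNorm Q.T₃ (incr s.x₃ k)) +
      2 * (1 - α) * sqNorm Q.S₂ (incr s.x₂ (k + 1)) + 2 * sqNorm Q.S₃ (incr s.x₃ (k + 1)) -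
      Q.σ ^ 2 / α * (sqNorm (crossOp P Q) (incr s.x₃ (k + 1)) +
        sqNorm (crossOp P Q) (incr s.x₃ k)) ≤
    2 * (1 - Q.τ) * Q.σ * ⟪res P s (k + 1),
        P.A₂.adjoint (incr s.x₂ (k + 1)) + P.A₃.adjoint (incr s.x₃ (k + 1))⟫_ℝ := by
  obtain ⟨m₁, m₂, m₃⟩ := hs.mem_dom hθ₁ hθ₂ hθ₃ (k + 1)
  obtain ⟨n₁, n₂, n₃⟩ := hs.mem_dom hθ₁ hθ₂ hθ₃ (k + 1 + 1)
  have k₂ := hmono₂ _ n₂ _ m₂ _ (hs.mem_subdiff₂ hθ₁ hθ₂ hθ₃ hT₂.1 (k + 1)) _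
    (hs.mem_subdiff₂ hθ₁ hθ₂ hθ₃ hT₂.1 k)
  have k₃ := hmono₃ _ n₃ _ m₃ _ (hs.mem_subdiff₃ hθ₁ hθ₂ hθ₃ hT₃.1 (k + 1)) _
    (hs.mem_subdiff₃ hθ₁ hθ₂ hθ₃ hT₃.1 k)
  rw [inner_neg_sub_sub_neg_sub, ← map_sub] at k₂ k₃
  change sqNorm _ (incr s.x₂ (k + 1)) ≤
    -⟪P.A₂.adjoint (incr s.x₂ (k + 1)), _⟫_ℝ - ⟪incr s.x₂ (k + 1), _⟫_ℝ at k₂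
  change sqNorm _ (incr s.x₃ (k + 1)) ≤
    -⟪P.A₃.adjoint (incr s.x₃ (k + 1)), _⟫_ℝ - ⟪incr s.x₃ (k + 1), _⟫_ℝ at k₃
  have q₂ := sqNorm_sub_le_inner hT₂ (incr s.x₂ (k + 1)) (incr s.x₂ k)
  have q₃ := sqNorm_sub_le_inner hT₃ (incr s.x₃ (k + 1)) (incr s.x₃ k)
  -- The block 2 condition involves both the new and the old Δx₃; each is absorbed with β = α.
  have y₁ := two_mul_inner_adjoint_le (P := P) hS₂ hσ (incr s.x₂ (k + 1)) (incr s.x₃ (k + 1)) hα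
  have y₂ := two_mul_inner_adjoint_le (P := P) hS₂ hσ (incr s.x₂ (k + 1)) (-incr s.x₃ k) hα
  rw [sqNorm_crossOp_neg, map_neg, inner_neg_right] at y₂
  have hz : s.z (k + 1) = s.z k + (Q.τ * Q.σ) • res P s (k + 1) := hs.stepz k
  rw [hz] at k₂ k₃
  simp only [inner_add_right, inner_sub_right, real_inner_smul_right] at k₂ k₃
  rw [inner_add_right, inner_add_right, real_inner_comm _ (res P s (k + 1 + 1)),
    real_inner_comm _ (res P s (k + 1 + 1)), real_inner_comm _ (res P s (k + 1)),
    real_inner_comm _ (res P s (k + 1))]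
  linarith

/-- The slack is a square: (1-τ)‖r₀ - b‖² for τ ≤ 1, and (1-τ⁻¹)‖r₀ + τb‖² for τ ≥ 1. -/
theorem min_residual_le {r r₀ b : Z} {τ : ℝ} (hτ : 0 < τ) :
    min τ (1 + τ - τ ^ 2) * (‖b‖ ^ 2 + τ⁻¹ * ‖r‖ ^ 2) +
        max (1 - τ) (1 - τ⁻¹) * (‖r‖ ^ 2 - ‖r₀‖ ^ 2) ≤
      (2 - τ) * ‖r‖ ^ 2 + ‖b‖ ^ 2 - 2 * (1 - τ) * ⟪r₀, b⟫_ℝ := by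
  have hi : τ * τ⁻¹ = 1 := mul_inv_cancel₀ hτ.ne'
  have hi0 : 0 < τ⁻¹ := inv_pos.2 hτ
  rcases le_total τ 1 with h | h
  · have h1 : min τ (1 + τ - τ ^ 2) = τ := min_eq_left (by nlinarith)
    have h2 : max (1 - τ) (1 - τ⁻¹) = 1 - τ := max_eq_left (by nlinarith)
    rw [h1, h2]
    have h3 := mul_nonneg (sub_nonneg.2 h) (sq_nonneg ‖r₀ - b‖)
    rw [norm_sub_sq_real] at h3
    have h4 : τ * (‖b‖ ^ 2 + τ⁻¹ * ‖r‖ ^ 2) = τ * ‖b‖ ^ 2 + ‖r‖ ^ 2 := by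
      rw [mul_add, ← mul_assoc, hi, one_mul]
    linarith
  · have h1 : min τ (1 + τ - τ ^ 2) = 1 + τ - τ ^ 2 := min_eq_right (by nlinarith)
    have h2 : max (1 - τ) (1 - τ⁻¹) = 1 - τ⁻¹ := max_eq_right (by nlinarith)
    rw [h1, h2]
    have h3 := mul_nonneg (mul_nonneg (sub_nonneg.2 h) hi0.le) (sq_nonneg ‖r₀ + τ • b‖)
    rw [norm_add_smul_sq] at h3
    have h4 : (τ - 1) * τ⁻¹ * (‖r₀‖ ^ 2 + 2 * τ * ⟪r₀, b⟫_ℝ + τ ^ 2 * ‖b‖ ^ 2) =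
        (1 - τ⁻¹) * ‖r₀‖ ^ 2 + 2 * (τ - 1) * ⟪r₀, b⟫_ℝ + (τ ^ 2 - τ) * ‖b‖ ^ 2 := by
      field_simp
    have h5 : (1 + τ - τ ^ 2) * (‖b‖ ^ 2 + τ⁻¹ * ‖r‖ ^ 2) =
        (1 + τ - τ ^ 2) * ‖b‖ ^ 2 + (τ⁻¹ + 1 - τ) * ‖r‖ ^ 2 := by
      field_simp
    linarith

theorem IsGenerated.t_add_le_merit_sub (hs : IsGenerated P Q s) (hθ₁ : ClosedProperConvex P.θ₁)
    (hθ₂ : ClosedProperConvex P.θ₂) (hθ₃ : ClosedProperConvex P.θ₃)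
    (hS₁ : Q.S₁.IsPositive) (hS₂ : PosDef Q.S₂) (hS₃ : Q.S₃.IsPositive)
    (hmono₁ : MonotoneWith P.θ₁ Q.S₁) (hmono₂ : MonotoneWith P.θ₂ Q.S₂)
    (hmono₃ : MonotoneWith P.θ₃ Q.S₃) (hσ : 0 < Q.σ) (hτ : 0 < Q.τ)
    (hT₁ : Q.T₁.IsPositive) (hT₂ : Q.T₂.IsPositive) (hT₃ : Q.T₃.IsPositive) {α : ℝ}
    (hα : 0 < α) (hα1 : α ≤ 1) {x₁ : X₁} {x₂ : X₂} {x₃ : X₃} {z : Z} (h : P.IsKKT x₁ x₂ x₃ z)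
    {k : ℕ} (hk : 1 ≤ k) :
    t P Q α s (k + 1) +
        min Q.τ (1 + Q.τ - Q.τ ^ 2) * Q.σ * Q.τ⁻¹ * ‖res P s (k + 1)‖ ^ 2 ≤
      merit P Q α s x₁ x₂ x₃ z k - merit P Q α s x₁ x₂ x₃ z (k + 1) := by
  -- Positivity of the index is needed because the optimality conditions of the preceding step
  -- enter.
  obtain ⟨k, rfl⟩ := Nat.exists_eq_add_of_le' hk
  have h1 := hs.phi_sub_phi_ge hθ₁ hθ₂ hθ₃ hS₁ hS₂ hS₃ hmono₁ hmono₂ hmono₃ hσ hτ hT₁ hT₂ hT₃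
    hα hα1 h (k + 1)
  have h2 := hs.inner_res_incr_le hθ₁ hθ₂ hθ₃ hS₂ hmono₂ hmono₃ hσ hT₂ hT₃ hα k
  have h3 := mul_le_mul_of_nonneg_left (min_residual_le (r := res P s (k + 1 + 1))
    (r₀ := res P s (k + 1))
    (b := P.A₂.adjoint (incr s.x₂ (k + 1)) + P.A₃.adjoint (incr s.x₃ (k + 1))) hτ) hσ.le
  simp only [t, merit, xi, Nat.add_sub_cancel, sqNorm_opH, sqNorm_add_op, sqNorm_smul_op]
  -- Each 5/2 in H is 1/2 from the KKT comparison plus 2 from the consecutive one; for K, one of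
  -- these two units arises by telescoping the old increment through `xi`.
  have e1 : 5 * Q.σ ^ 2 / (2 * α) = 5 / 2 * (Q.σ ^ 2 / α) := by ring
  have e2 : Q.σ ^ 2 / (2 * α) = 1 / 2 * (Q.σ ^ 2 / α) := by ring
  rw [e2] at h1
  rw [e1]
  linarith

end Descent

/-! ### Coercivity and elementary limits -/

section Coercive

variable {E F : Type*} [NormedAddCommGroup E] [InnerProductSpace ℝ E] [FiniteDimensional ℝ E]
  [NormedAddCommGroup F] [InnerProductSpace ℝ F] [FiniteDimensional ℝ F]

theorem continuous_sqNorm (G : E →ₗ[ℝ] E) : Continuous (sqNorm G) :=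
  continuous_id.inner G.continuous_of_finiteDimensional

theorem tendsto_sqNorm_zero (G : E →ₗ[ℝ] E) {x : ℕ → E} (hx : Tendsto x atTop (𝓝 0)) :
    Tendsto (fun n => sqNorm G (x n)) atTop (𝓝 0) := by
  have h := ((continuous_sqNorm G).tendsto 0).comp hx
  rwa [show sqNorm G 0 = 0 by simp [sqNorm]] at h

theorem tendsto_map_zero (A : E →ₗ[ℝ] F) {x : ℕ → E} (hx : Tendsto x atTop (𝓝 0)) :
    Tendsto (fun n => A (x n)) atTop (𝓝 0) := by
  have h := (A.continuous_of_finiteDimensional.tendsto 0).comp hx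
  rwa [map_zero] at h

theorem PosDef.exists_norm_sq_le {G : E →ₗ[ℝ] E} (hG : PosDef G) :
    ∃ C : ℝ, 0 < C ∧ ∀ x, ‖x‖ ^ 2 ≤ C * sqNorm G x := by
  rcases subsingleton_or_nontrivial E with h | h
  · exact ⟨1, one_pos, fun x => by simp [Subsingleton.elim x 0, sqNorm]⟩
  obtain ⟨e, he, hmin⟩ := (isCompact_sphere (0 : E) 1).exists_isMinOn
    (NormedSpace.sphere_nonempty.2 zero_le_one) (continuous_sqNorm G).continuousOn
  have hpos : 0 < sqNorm G e := hG.2 e (ne_zero_of_mem_unit_sphere ⟨e, he⟩)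
  refine ⟨(sqNorm G e)⁻¹, inv_pos.2 hpos, fun x => ?_⟩
  rcases eq_or_ne x 0 with rfl | hx
  · simp [sqNorm]
  have hn : ‖x‖ ≠ 0 := norm_ne_zero_iff.2 hx
  have h1 : sqNorm G e ≤ sqNorm G (‖x‖⁻¹ • x) :=
    hmin (by simp [norm_smul, hn])
  have h2 : sqNorm G (‖x‖⁻¹ • x) = (‖x‖ ^ 2)⁻¹ * sqNorm G x := by
    simp only [sqNorm, map_smul, real_inner_smul_left, real_inner_smul_right]
    field_simp
  rw [h2, le_inv_mul_iff₀ (by positivity)] at h1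
  rw [le_inv_mul_iff₀ hpos]
  linarith

theorem tendsto_zero_of_norm_sq_le {x : ℕ → E} {a : ℕ → ℝ} (h : ∀ n, ‖x n‖ ^ 2 ≤ a n)
    (ha : Tendsto a atTop (𝓝 0)) : Tendsto x atTop (𝓝 0) := by
  have h1 : Tendsto (fun n => ‖x n‖ ^ 2) atTop (𝓝 0) :=
    squeeze_zero (fun n => sq_nonneg _) h ha
  have h2 := h1.sqrt
  simp only [Real.sqrt_sq (norm_nonneg _), Real.sqrt_zero] at h2
  exact tendsto_zero_iff_norm_tendsto_zero.2 h2

theorem PosDef.tendsto_zero {G : E →ₗ[ℝ] E} (hG : PosDef G) {x : ℕ → E}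
    (h : Tendsto (fun n => sqNorm G (x n)) atTop (𝓝 0)) : Tendsto x atTop (𝓝 0) := by
  obtain ⟨C, -, hC⟩ := hG.exists_norm_sq_le
  exact tendsto_zero_of_norm_sq_le (fun n => hC (x n)) (by simpa using h.const_mul C)

theorem norm_sq_fst_le (x : E) (y : F) : ‖x‖ ^ 2 ≤ ‖WithLp.toLp 2 (x, y)‖ ^ 2 := by
  rw [WithLp.prod_norm_sq_eq_of_L2]
  exact le_add_of_nonneg_right (sq_nonneg _)

theorem norm_sq_snd_le (x : E) (y : F) : ‖y‖ ^ 2 ≤ ‖WithLp.toLp 2 (x, y)‖ ^ 2 := by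
  rw [WithLp.prod_norm_sq_eq_of_L2]
  exact le_add_of_nonneg_left (sq_nonneg _)

theorem tendsto_neg_apply_sub (A : F →ₗ[ℝ] E) (T : E →ₗ[ℝ] E) {ζ ρ : ℕ → F} {d : ℕ → E} {z : F}
    (σ : ℝ) (hζ : Tendsto ζ atTop (𝓝 z)) (hρ : Tendsto ρ atTop (𝓝 0))
    (hd : Tendsto d atTop (𝓝 0)) :
    Tendsto (fun n => -A (ζ n + σ • ρ n) - T (d n)) atTop (𝓝 (-A z)) := by
  have h1 : Tendsto (fun n => ζ n + σ • ρ n) atTop (𝓝 z) := by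
    simpa using hζ.add (hρ.const_smul σ)
  simpa using ((A.continuous_of_finiteDimensional.tendsto z).comp h1).neg.sub
    (tendsto_map_zero T hd)

theorem mem_closedBall_sqrt {x x₀ : E} {W : ℝ} (h : ‖x - x₀‖ ^ 2 ≤ W) :
    x ∈ Metric.closedBall x₀ √W := by
  rw [mem_closedBall_iff_norm]
  exact Real.le_sqrt_of_sq_le h

end Coercive

/-- The decrements of a nonnegative nonincreasing sequence tend to zero. -/
theorem tendsto_sub_succ_zero {a : ℕ → ℝ} (ha : Antitone a) (h0 : ∀ n, 0 ≤ a n) :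
    Tendsto (fun n => a n - a (n + 1)) atTop (𝓝 0) := by
  have h := tendsto_atTop_ciInf ha ⟨0, by rintro _ ⟨n, rfl⟩; exact h0 n⟩
  simpa using h.sub (h.comp (tendsto_add_atTop_nat 1))

theorem tendsto_zero_of_antitone_of_subseq {a : ℕ → ℝ} (ha : Antitone a) (h0 : ∀ n, 0 ≤ a n)
    {φ : ℕ → ℕ} (hφ : StrictMono φ) (h : Tendsto (a ∘ φ) atTop (𝓝 0)) :
    Tendsto a atTop (𝓝 0) := by
  have h1 := tendsto_atTop_ciInf ha ⟨0, by rintro _ ⟨n, rfl⟩; exact h0 n⟩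
  rwa [tendsto_nhds_unique (h1.comp hφ.tendsto_atTop) h] at h1

/-! ### Convergence of the whole sequence -/

section Convergence

variable {X₁ X₂ X₃ Z : Type*}
  [NormedAddCommGroup X₁] [InnerProductSpace ℝ X₁] [FiniteDimensional ℝ X₁]
  [NormedAddCommGroup X₂] [InnerProductSpace ℝ X₂] [FiniteDimensional ℝ X₂]
  [NormedAddCommGroup X₃] [InnerProductSpace ℝ X₃] [FiniteDimensional ℝ X₃]
  [NormedAddCommGroup Z] [InnerProductSpace ℝ Z] [FiniteDimensional ℝ Z]
  {P : Problem X₁ X₂ X₃ Z} {Q : Params X₁ X₂ X₃} {s : Iterates X₁ X₂ X₃ Z}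

theorem phi_nonneg (hS₁ : Q.S₁.IsPositive) (hT₁ : Q.T₁.IsPositive) (hσ : 0 < Q.σ)
    (hτ : 0 < Q.τ) {α : ℝ} (hM : PosDef (opM P Q α)) (x₁ : X₁) (x₂ : X₂) (x₃ : X₃) (z : Z)
    (k : ℕ) : 0 ≤ phi P Q α s x₁ x₂ x₃ z k := by
  have h1 := sqNorm_nonneg (hS₁.add hT₁) (s.x₁ k - x₁)
  have h2 := hM.sqNorm_nonneg (WithLp.toLp 2 (s.x₂ k - x₂, s.x₃ k - x₃))
  unfold phi
  positivity

theorem xi_nonneg (hS₂ : PosDef Q.S₂) (hT₂ : Q.T₂.IsPositive) (hT₃ : Q.T₃.IsPositive)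
    {α : ℝ} (hα : 0 < α) (k : ℕ) : 0 ≤ xi P Q α s k := by
  have h1 := sqNorm_nonneg hT₂ (incr s.x₂ (k - 1))
  have h2 := sqNorm_nonneg hT₃ (incr s.x₃ (k - 1))
  have h3 := sqNorm_crossOp_nonneg (P := P) hS₂ (incr s.x₃ (k - 1))
  simp only [xi, sqNorm_add_op, sqNorm_smul_op]
  positivity

theorem max_one_sub_nonneg (τ : ℝ) : 0 ≤ max (1 - τ) (1 - τ⁻¹) := by
  rcases le_total τ 1 with h | h
  · exact le_max_of_le_left (sub_nonneg.2 h)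
  · exact le_max_of_le_right (sub_nonneg.2 (inv_le_one_of_one_le₀ h))

theorem phi_le_merit (hS₂ : PosDef Q.S₂) (hT₂ : Q.T₂.IsPositive) (hT₃ : Q.T₃.IsPositive)
    (hσ : 0 < Q.σ) {α : ℝ} (hα : 0 < α) (x₁ : X₁) (x₂ : X₂) (x₃ : X₃) (z : Z)
    (k : ℕ) : phi P Q α s x₁ x₂ x₃ z k ≤ merit P Q α s x₁ x₂ x₃ z k := by
  have h1 := xi_nonneg (P := P) (s := s) hS₂ hT₂ hT₃ hα k
  have h2 := max_one_sub_nonneg Q.τ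
  have h3 : 0 ≤ max (1 - Q.τ) (1 - Q.τ⁻¹) * Q.σ * ‖res P s k‖ ^ 2 := by positivity
  unfold merit
  linarith

/-- The distance of an iterate to a feasible point is controlled by `phi` and the residual. -/
theorem exists_norm_sq_sub_le (hS₁ : Q.S₁.IsPositive) (hT₁ : Q.T₁.IsPositive)
    (hS₂ : PosDef Q.S₂) (hS₃ : Q.S₃.IsPositive) (hT₂ : Q.T₂.IsPositive) (hT₃ : Q.T₃.IsPositive)
    (hσ : 0 < Q.σ) (hτ : 0 < Q.τ) {α : ℝ} (hα1 : α ≤ 1)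
    (hG : PosDef ((1 / 2 : ℝ) • Q.S₁ + Q.T₁ + Q.σ • (P.A₁ ∘ₗ P.A₁.adjoint)))
    (hM : PosDef (opM P Q α)) (s : Iterates X₁ X₂ X₃ Z) :
    ∃ C : ℝ, ∀ x₁ x₂ x₃ z, P.residual x₁ x₂ x₃ = 0 → ∀ k,
      ‖s.x₁ k - x₁‖ ^ 2 ≤ C * (phi P Q α s x₁ x₂ x₃ z k + ‖res P s k‖ ^ 2) ∧
      ‖s.x₂ k - x₂‖ ^ 2 ≤ C * (phi P Q α s x₁ x₂ x₃ z k + ‖res P s k‖ ^ 2) ∧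
      ‖s.x₃ k - x₃‖ ^ 2 ≤ C * (phi P Q α s x₁ x₂ x₃ z k + ‖res P s k‖ ^ 2) ∧
      ‖s.z k - z‖ ^ 2 ≤ C * (phi P Q α s x₁ x₂ x₃ z k + ‖res P s k‖ ^ 2) := by
  obtain ⟨C₁, hC₁, h₁⟩ := hG.exists_norm_sq_le
  obtain ⟨C₂, hC₂, h₂⟩ := hM.exists_norm_sq_le
  -- The summands serve x₁, then (x₂, x₃), then z. For x₁, feasibility of the reference point gives
  -- σ‖a‖² ≤ 2σ‖r‖² + 2σ‖b‖² with σ‖b‖² ≤ φ. The constant does not depend on the reference point, so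
  -- it can be reused at the cluster point.
  refine ⟨C₁ * (3 + 2 * Q.σ) + C₂ + Q.σ * Q.τ, fun x₁ x₂ x₃ z hx k => ?_⟩
  have hr := residual_sub_residual (s.x₁ k) x₁ (s.x₂ k) x₂ (s.x₃ k) x₃ hx
  change _ = res P s k at hr
  set b := P.A₂.adjoint (s.x₂ k - x₂) + P.A₃.adjoint (s.x₃ k - x₃) with hb
  set a := P.A₁.adjoint (s.x₁ k - x₁)
  set φ := phi P Q α s x₁ x₂ x₃ z k with hφ
  have hφ0 : 0 ≤ φ := phi_nonneg hS₁ hT₁ hσ hτ hM x₁ x₂ x₃ z k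
  have ha : ‖a‖ ^ 2 ≤ 2 * ‖res P s k‖ ^ 2 + 2 * ‖b‖ ^ 2 := by
    have e : a = res P s k - b := by rw [← hr, hb]; abel
    rw [e]
    have h1 := sq_nonneg ‖res P s k + b‖
    rw [norm_add_sq_real] at h1
    rw [norm_sub_sq_real]
    linarith
  have p1 := sqNorm_nonneg hS₁ (s.x₁ k - x₁)
  have p2 := sqNorm_nonneg hT₁ (s.x₁ k - x₁)
  have p3 : 0 ≤ (1 - α) * sqNorm Q.S₂ (s.x₂ k - x₂) :=
    mul_nonneg (sub_nonneg.2 hα1) (hS₂.sqNorm_nonneg _)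
  have p4 := sqNorm_nonneg hT₂ (s.x₂ k - x₂)
  have p5 := sqNorm_nonneg hS₃ (s.x₃ k - x₃)
  have p6 := sqNorm_nonneg hT₃ (s.x₃ k - x₃)
  have p7 : 0 ≤ (Q.σ * Q.τ)⁻¹ * ‖s.z k - z‖ ^ 2 := by positivity
  have p8 : 0 ≤ Q.σ * ‖b‖ ^ 2 := by positivity
  have hM' := sqNorm_opM (P := P) (Q := Q) α (s.x₂ k - x₂) (s.x₃ k - x₃)
  rw [← hb] at hM'
  have hφ' : φ = (Q.σ * Q.τ)⁻¹ * ‖s.z k - z‖ ^ 2 +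
      (sqNorm Q.S₁ (s.x₁ k - x₁) + sqNorm Q.T₁ (s.x₁ k - x₁)) +
      sqNorm (opM P Q α) (WithLp.toLp 2 (s.x₂ k - x₂, s.x₃ k - x₃)) := by
    rw [hφ, phi, sqNorm_add_op]
  have hR : 0 ≤ ‖res P s k‖ ^ 2 := sq_nonneg _
  have b1 : sqNorm ((1 / 2 : ℝ) • Q.S₁ + Q.T₁ + Q.σ • (P.A₁ ∘ₗ P.A₁.adjoint))
      (s.x₁ k - x₁) ≤ (3 + 2 * Q.σ) * (φ + ‖res P s k‖ ^ 2) := by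
    rw [sqNorm_add_op, sqNorm_add_op, sqNorm_smul_op, sqNorm_smul_op, sqNorm_comp_adjoint]
    have h1 := mul_le_mul_of_nonneg_left ha hσ.le
    have h2 : 0 ≤ Q.σ * φ := mul_nonneg hσ.le hφ0
    linarith
  have b2 : sqNorm (opM P Q α) (WithLp.toLp 2 (s.x₂ k - x₂, s.x₃ k - x₃)) ≤
      φ + ‖res P s k‖ ^ 2 := by linarith
  have b3 : ‖s.z k - z‖ ^ 2 ≤ Q.σ * Q.τ * (φ + ‖res P s k‖ ^ 2) := by
    rw [← inv_mul_le_iff₀ (mul_pos hσ hτ)]; linarith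
  have hw : 0 ≤ φ + ‖res P s k‖ ^ 2 := add_nonneg hφ0 hR
  have c1 := (h₁ (s.x₁ k - x₁)).trans (mul_le_mul_of_nonneg_left b1 hC₁.le)
  have c2 := (h₂ (WithLp.toLp 2 (s.x₂ k - x₂, s.x₃ k - x₃))).trans
    (mul_le_mul_of_nonneg_left b2 hC₂.le)
  have w1 : 0 ≤ C₁ * (3 + 2 * Q.σ) * (φ + ‖res P s k‖ ^ 2) := by positivity
  have w2 : 0 ≤ C₂ * (φ + ‖res P s k‖ ^ 2) := by positivity
  have w3 : 0 ≤ Q.σ * Q.τ * (φ + ‖res P s k‖ ^ 2) := by positivity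
  refine ⟨?_, ?_, ?_, ?_⟩
  · linarith
  · linarith [norm_sq_fst_le (s.x₂ k - x₂) (s.x₃ k - x₃)]
  · linarith [norm_sq_snd_le (s.x₂ k - x₂) (s.x₃ k - x₃)]
  · linarith

/-- The golden ratio is the positive root: 4(1 + τ - τ²) = (√5 - (2τ-1))(√5 + (2τ-1)). -/
theorem min_step_pos {τ : ℝ} (hτ : 0 < τ) (h : τ < (1 + √5) / 2) :
    0 < min τ (1 + τ - τ ^ 2) := by
  have h5 : √5 ^ 2 = 5 := Real.sq_sqrt (by norm_num)
  refine lt_min hτ ?_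
  have h1 : 1 < √5 := by rw [Real.lt_sqrt zero_le_one]; norm_num
  have h2 : 0 < (√5 - (2 * τ - 1)) * (√5 + (2 * τ - 1)) :=
    mul_pos (by linarith) (by linarith)
  linarith

/-- Increments and residuals vanish when the merit function decreases. -/
theorem tendsto_incr_zero (hS₁ : Q.S₁.IsPositive) (hT₁ : Q.T₁.IsPositive) (hσ : 0 < Q.σ)
    (hτ : 0 < Q.τ) (hτ' : Q.τ < (1 + √5) / 2) {α : ℝ}
    (hG : PosDef ((1 / 2 : ℝ) • Q.S₁ + Q.T₁ + Q.σ • (P.A₁ ∘ₗ P.A₁.adjoint)))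
    (hH : PosDef (opH P Q α)) {a : ℕ → ℝ} (ha : Antitone a) (h0 : ∀ n, 0 ≤ a n)
    (hle : ∀ n, t P Q α s (n + 1 + 1) +
      min Q.τ (1 + Q.τ - Q.τ ^ 2) * Q.σ * Q.τ⁻¹ * ‖res P s (n + 1 + 1)‖ ^ 2 ≤ a n - a (n + 1)) :
    Tendsto (fun n => res P s (n + 1)) atTop (𝓝 0) ∧
      Tendsto (incr s.x₁) atTop (𝓝 0) ∧ Tendsto (incr s.x₂) atTop (𝓝 0) ∧
      Tendsto (incr s.x₃) atTop (𝓝 0) := by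
  have hd := tendsto_sub_succ_zero ha h0
  have hμ := min_step_pos hτ hτ'
  set μ := min Q.τ (1 + Q.τ - Q.τ ^ 2) * Q.σ * Q.τ⁻¹ with hμ'
  have hμ0 : 0 < μ := by positivity
  have hV : ((1 / 2 : ℝ) • Q.S₁ + Q.T₁).IsPositive :=
    (LinearMap.IsPositive.smul_of_nonneg hS₁ (by norm_num)).add hT₁
  have p1 : ∀ n, 0 ≤ sqNorm ((1 / 2 : ℝ) • Q.S₁ + Q.T₁) (incr s.x₁ (n + 1)) := fun n =>
    sqNorm_nonneg hV _
  have p2 : ∀ n, 0 ≤ sqNorm (opH P Q α)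
      (WithLp.toLp 2 (incr s.x₂ (n + 1), incr s.x₃ (n + 1))) := fun n => hH.sqNorm_nonneg _
  have p3 : ∀ n, 0 ≤ μ * ‖res P s (n + 1 + 1)‖ ^ 2 := fun n => by positivity
  simp only [t, Nat.add_sub_cancel] at hle
  have hr' : Tendsto (fun n => res P s (n + 1 + 1)) atTop (𝓝 0) :=
    tendsto_zero_of_norm_sq_le (a := fun n => μ⁻¹ * (a n - a (n + 1)))
      (fun n => by rw [le_inv_mul_iff₀ hμ0]; linarith [hle n, p1 n, p2 n])
      (by simpa using hd.const_mul μ⁻¹)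
  have hr : Tendsto (fun n => res P s (n + 1)) atTop (𝓝 0) :=
    (tendsto_add_atTop_iff_nat (f := fun n => res P s (n + 1)) 1).1 hr'
  have hu : Tendsto (fun n => WithLp.toLp 2 (incr s.x₂ (n + 1), incr s.x₃ (n + 1))) atTop
      (𝓝 0) :=
    hH.tendsto_zero (squeeze_zero p2 (fun n => by linarith [hle n, p1 n, p3 n]) hd)
  have hu' := (tendsto_zero_iff_norm_tendsto_zero.1 hu).pow 2
  rw [zero_pow two_ne_zero] at hu'
  have h2' : Tendsto (fun n => incr s.x₂ (n + 1)) atTop (𝓝 0) :=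
    tendsto_zero_of_norm_sq_le (fun n => norm_sq_fst_le _ (incr s.x₃ (n + 1))) hu'
  have h3' : Tendsto (fun n => incr s.x₃ (n + 1)) atTop (𝓝 0) :=
    tendsto_zero_of_norm_sq_le (fun n => norm_sq_snd_le (incr s.x₂ (n + 1)) _) hu'
  -- `t` controls Δx₁ only in the seminorm of ½Σ₁ + T₁; differencing the residuals controls A₁*Δx₁,
  -- the missing part of the definite operator in `hG`.
  have hA : Tendsto (fun n => P.A₁.adjoint (incr s.x₁ (n + 1))) atTop (𝓝 0) := by
    have e : ∀ n, P.A₁.adjoint (incr s.x₁ (n + 1)) = res P s (n + 1 + 1) - res P s (n + 1) -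
        P.A₂.adjoint (incr s.x₂ (n + 1)) - P.A₃.adjoint (incr s.x₃ (n + 1)) := by
      intro n
      simp only [res, Problem.residual, incr, map_sub]
      abel
    simp only [e]
    simpa using ((hr'.sub hr).sub (tendsto_map_zero _ h2')).sub (tendsto_map_zero _ h3')
  have h1' : Tendsto (fun n => incr s.x₁ (n + 1)) atTop (𝓝 0) := by
    refine hG.tendsto_zero ?_
    simp only [sqNorm_add_op _ (Q.σ • (P.A₁ ∘ₗ P.A₁.adjoint)), sqNorm_smul_op Q.σ,
      sqNorm_comp_adjoint]
    have h1 := squeeze_zero p1 (fun n => by linarith [hle n, p2 n, p3 n]) hd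
    simpa using h1.add (((tendsto_zero_iff_norm_tendsto_zero.1 hA).pow 2).const_mul Q.σ)
  exact ⟨hr, (tendsto_add_atTop_iff_nat (f := incr s.x₁) 1).1 h1',
    (tendsto_add_atTop_iff_nat (f := incr s.x₂) 1).1 h2',
    (tendsto_add_atTop_iff_nat (f := incr s.x₃) 1).1 h3'⟩

/-- Cluster points of the iterates are KKT points. -/
theorem IsGenerated.isKKT_of_tendsto (hs : IsGenerated P Q s) (hθ₁ : ClosedProperConvex P.θ₁)
    (hθ₂ : ClosedProperConvex P.θ₂) (hθ₃ : ClosedProperConvex P.θ₃)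
    (hT₁ : Q.T₁.IsPositive) (hT₂ : Q.T₂.IsPositive) (hT₃ : Q.T₃.IsPositive)
    (hr : Tendsto (fun n => res P s (n + 1)) atTop (𝓝 0))
    (h₁ : Tendsto (incr s.x₁) atTop (𝓝 0)) (h₂ : Tendsto (incr s.x₂) atTop (𝓝 0))
    (h₃ : Tendsto (incr s.x₃) atTop (𝓝 0)) {φ : ℕ → ℕ} (hφ : StrictMono φ)
    {x₁ : X₁} {x₂ : X₂} {x₃ : X₃} {z : Z}
    (hx₁ : Tendsto (fun n => s.x₁ (φ n + 1)) atTop (𝓝 x₁))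
    (hx₂ : Tendsto (fun n => s.x₂ (φ n + 1)) atTop (𝓝 x₂))
    (hx₃ : Tendsto (fun n => s.x₃ (φ n + 1)) atTop (𝓝 x₃))
    (hz : Tendsto (fun n => s.z (φ n + 1)) atTop (𝓝 z)) : P.IsKKT x₁ x₂ x₃ z := by
  have hφt := hφ.tendsto_atTop
  have hr' : Tendsto (fun n => res P s (φ n + 1)) atTop (𝓝 0) := hr.comp hφt
  have h₁' : Tendsto (fun n => incr s.x₁ (φ n)) atTop (𝓝 0) := h₁.comp hφt
  have h₂' : Tendsto (fun n => incr s.x₂ (φ n)) atTop (𝓝 0) := h₂.comp hφt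
  have h₃' : Tendsto (fun n => incr s.x₃ (φ n)) atTop (𝓝 0) := h₃.comp hφt
  -- The subgradients at step φ n + 1 involve the previous multiplier, which has the same limit as
  -- the residual vanishes.
  have hz' : Tendsto (fun n => s.z (φ n)) atTop (𝓝 z) := by
    have e : ∀ n, s.z (φ n) = s.z (φ n + 1) - (Q.τ * Q.σ) • res P s (φ n + 1) := fun n => by
      rw [hs.stepz, res]; abel
    simp only [e]
    simpa using hz.sub (hr'.const_smul (Q.τ * Q.σ))
  refine ⟨?_, ?_, ?_, ?_⟩
  · refine hθ₁.mem_subdiff_of_tendsto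
      (fun n => hs.mem_subdiff₁ hθ₁ hθ₂ hθ₃ hT₁.1 (φ n)) hx₁ (tendsto_neg_apply_sub _ _ _ hz' ?_ h₁')
    simpa using (hr'.sub (tendsto_map_zero _ h₂')).sub (tendsto_map_zero _ h₃')
  · refine hθ₂.mem_subdiff_of_tendsto
      (fun n => hs.mem_subdiff₂ hθ₁ hθ₂ hθ₃ hT₂.1 (φ n)) hx₂ (tendsto_neg_apply_sub _ _ _ hz' ?_ h₂')
    simpa using hr'.sub (tendsto_map_zero _ h₃')
  · exact hθ₃.mem_subdiff_of_tendsto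
      (fun n => hs.mem_subdiff₃ hθ₁ hθ₂ hθ₃ hT₃.1 (φ n)) hx₃ (tendsto_neg_apply_sub _ _ _ hz' hr' h₃')
  · refine tendsto_nhds_unique ?_ hr'
    exact ((((P.A₁.adjoint.continuous_of_finiteDimensional.tendsto x₁).comp hx₁).add
      ((P.A₂.adjoint.continuous_of_finiteDimensional.tendsto x₂).comp hx₂)).add
      ((P.A₃.adjoint.continuous_of_finiteDimensional.tendsto x₃).comp hx₃)).sub
      tendsto_const_nhds

theorem tendsto_merit_zero {α : ℝ} (hr : Tendsto (fun n => res P s (n + 1)) atTop (𝓝 0))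
    (h₂ : Tendsto (incr s.x₂) atTop (𝓝 0)) (h₃ : Tendsto (incr s.x₃) atTop (𝓝 0))
    {φ : ℕ → ℕ} (hφ : StrictMono φ) {x₁ : X₁} {x₂ : X₂} {x₃ : X₃} {z : Z}
    (hx₁ : Tendsto (fun n => s.x₁ (φ n + 1)) atTop (𝓝 x₁))
    (hx₂ : Tendsto (fun n => s.x₂ (φ n + 1)) atTop (𝓝 x₂))
    (hx₃ : Tendsto (fun n => s.x₃ (φ n + 1)) atTop (𝓝 x₃))
    (hz : Tendsto (fun n => s.z (φ n + 1)) atTop (𝓝 z)) :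
    Tendsto (fun n => merit P Q α s x₁ x₂ x₃ z (φ n + 1)) atTop (𝓝 0) := by
  have hφt := hφ.tendsto_atTop
  have hr' : Tendsto (fun n => res P s (φ n + 1)) atTop (𝓝 0) := hr.comp hφt
  have h₂' : Tendsto (fun n => incr s.x₂ (φ n)) atTop (𝓝 0) := h₂.comp hφt
  have h₃' : Tendsto (fun n => incr s.x₃ (φ n)) atTop (𝓝 0) := h₃.comp hφt
  have hsq : ∀ {y : ℕ → Z}, Tendsto y atTop (𝓝 0) → ∀ c : ℝ,
      Tendsto (fun n => c * ‖y n‖ ^ 2) atTop (𝓝 0) := fun hy c => by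
    simpa using ((tendsto_zero_iff_norm_tendsto_zero.1 hy).pow 2).const_mul c
  have e₁ := tendsto_sub_nhds_zero_iff.2 hx₁
  have e₂ := tendsto_sub_nhds_zero_iff.2 hx₂
  have e₃ := tendsto_sub_nhds_zero_iff.2 hx₃
  have eB : Tendsto (fun n => P.A₂.adjoint (s.x₂ (φ n + 1) - x₂) +
      P.A₃.adjoint (s.x₃ (φ n + 1) - x₃)) atTop (𝓝 0) := by
    simpa using (tendsto_map_zero P.A₂.adjoint e₂).add (tendsto_map_zero P.A₃.adjoint e₃)
  simp only [merit, phi, xi, Nat.add_sub_cancel, sqNorm_opM]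
  simpa using (((hsq (tendsto_sub_nhds_zero_iff.2 hz) (Q.σ * Q.τ)⁻¹).add
    (tendsto_sqNorm_zero (Q.S₁ + Q.T₁) e₁)).add
    (((((tendsto_sqNorm_zero Q.S₂ e₂).const_mul (1 - α)).add (tendsto_sqNorm_zero Q.T₂ e₂)).add
      ((tendsto_sqNorm_zero Q.S₃ e₃).add (tendsto_sqNorm_zero Q.T₃ e₃))).add
      (hsq eB Q.σ))).add (hsq hr' (max (1 - Q.τ) (1 - Q.τ⁻¹) * Q.σ)) |>.add
    ((tendsto_sqNorm_zero Q.T₂ h₂').add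
      (tendsto_sqNorm_zero (Q.T₃ + (Q.σ ^ 2 / α) • crossOp P Q) h₃'))

theorem IsGenerated.exists_isKKT_tendsto (hs : IsGenerated P Q s)
    (hθ₁ : ClosedProperConvex P.θ₁)
    (hθ₂ : ClosedProperConvex P.θ₂) (hθ₃ : ClosedProperConvex P.θ₃)
    (hS₁ : Q.S₁.IsPositive) (hS₂ : PosDef Q.S₂) (hS₃ : Q.S₃.IsPositive)
    (hmono₁ : MonotoneWith P.θ₁ Q.S₁) (hmono₂ : MonotoneWith P.θ₂ Q.S₂)
    (hmono₃ : MonotoneWith P.θ₃ Q.S₃) (hσ : 0 < Q.σ) (hτ : 0 < Q.τ)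
    (hτ' : Q.τ < (1 + √5) / 2)
    (hT₁ : Q.T₁.IsPositive) (hT₂ : Q.T₂.IsPositive) (hT₃ : Q.T₃.IsPositive) {α : ℝ}
    (hα : 0 < α) (hα1 : α ≤ 1)
    (hG : PosDef ((1 / 2 : ℝ) • Q.S₁ + Q.T₁ + Q.σ • (P.A₁ ∘ₗ P.A₁.adjoint)))
    (hH : PosDef (opH P Q α)) (hM : PosDef (opM P Q α))
    (hkkt : ∃ x₁ x₂ x₃ z, P.IsKKT x₁ x₂ x₃ z) :
    ∃ x₁ x₂ x₃ z, P.IsKKT x₁ x₂ x₃ z ∧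
      Tendsto s.x₁ atTop (𝓝 x₁) ∧ Tendsto s.x₂ atTop (𝓝 x₂) ∧
      Tendsto s.x₃ atTop (𝓝 x₃) ∧ Tendsto s.z atTop (𝓝 z) := by
  have hdesc : ∀ {x₁ x₂ x₃ z}, P.IsKKT x₁ x₂ x₃ z → ∀ n,
      t P Q α s (n + 1 + 1) + min Q.τ (1 + Q.τ - Q.τ ^ 2) * Q.σ * Q.τ⁻¹ *
        ‖res P s (n + 1 + 1)‖ ^ 2 ≤
      merit P Q α s x₁ x₂ x₃ z (n + 1) - merit P Q α s x₁ x₂ x₃ z (n + 1 + 1) := fun h n =>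
    hs.t_add_le_merit_sub hθ₁ hθ₂ hθ₃ hS₁ hS₂ hS₃ hmono₁ hmono₂ hmono₃ hσ hτ hT₁ hT₂ hT₃ hα hα1
      h (Nat.le_add_left 1 n)
  have hanti : ∀ {x₁ x₂ x₃ z}, P.IsKKT x₁ x₂ x₃ z →
      Antitone fun n => merit P Q α s x₁ x₂ x₃ z (n + 1) := by
    intro x₁ x₂ x₃ z h
    refine antitone_nat_of_succ_le fun n => ?_
    have h1 := hdesc h n
    have h2 := sqNorm_nonneg ((LinearMap.IsPositive.smul_of_nonneg hS₁
      (by norm_num : (0 : ℝ) ≤ 1 / 2)).add hT₁) (incr s.x₁ (n + 1))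
    have h3 := hH.sqNorm_nonneg (WithLp.toLp 2 (incr s.x₂ (n + 1), incr s.x₃ (n + 1)))
    have h4 := min_step_pos hτ hτ'
    have h5 : 0 ≤ min Q.τ (1 + Q.τ - Q.τ ^ 2) * Q.σ * Q.τ⁻¹ * ‖res P s (n + 1 + 1)‖ ^ 2 := by
      positivity
    simp only [t, Nat.add_sub_cancel] at h1
    linarith
  have hnn : ∀ x₁ x₂ x₃ z n, 0 ≤ merit P Q α s x₁ x₂ x₃ z n := fun x₁ x₂ x₃ z n =>
    (phi_nonneg hS₁ hT₁ hσ hτ hM x₁ x₂ x₃ z n).trans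
      (phi_le_merit hS₂ hT₂ hT₃ hσ hα x₁ x₂ x₃ z n)
  obtain ⟨y₁, y₂, y₃, y, hy⟩ := hkkt
  obtain ⟨hr, h₁, h₂, h₃⟩ := tendsto_incr_zero hS₁ hT₁ hσ hτ hτ' hG hH (hanti hy)
    (fun n => hnn _ _ _ _ _) (hdesc hy)
  have hr2 : Tendsto (fun n => ‖res P s (n + 1)‖ ^ 2) atTop (𝓝 0) := by
    simpa using (tendsto_zero_iff_norm_tendsto_zero.1 hr).pow 2
  obtain ⟨C, hC⟩ := exists_norm_sq_sub_le hS₁ hT₁ hS₂ hS₃ hT₂ hT₃ hσ hτ hα1 hG hM s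
  obtain ⟨R, hR⟩ := hr2.bddAbove_range
  set W := |C| * (merit P Q α s y₁ y₂ y₃ y 1 + R)
  have hW : ∀ n, C * (phi P Q α s y₁ y₂ y₃ y (n + 1) + ‖res P s (n + 1)‖ ^ 2) ≤ W := by
    intro n
    have a1 := phi_nonneg (s := s) hS₁ hT₁ hσ hτ hM y₁ y₂ y₃ y (n + 1)
    have a2 := phi_le_merit (P := P) (s := s) hS₂ hT₂ hT₃ hσ hα y₁ y₂ y₃ y (n + 1)
    have a3 : merit P Q α s y₁ y₂ y₃ y (n + 1) ≤ merit P Q α s y₁ y₂ y₃ y 1 :=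
      hanti hy (Nat.zero_le n)
    have a4 : ‖res P s (n + 1)‖ ^ 2 ≤ R := hR ⟨n, rfl⟩
    have a5 : 0 ≤ phi P Q α s y₁ y₂ y₃ y (n + 1) + ‖res P s (n + 1)‖ ^ 2 := by positivity
    exact mul_le_mul (le_abs_self C) (by linarith) a5 (abs_nonneg C)
  have hK := ((isCompact_closedBall y₁ √W).prod ((isCompact_closedBall y₂ √W).prod
    ((isCompact_closedBall y₃ √W).prod (isCompact_closedBall y √W))))
  obtain ⟨⟨x₁, x₂, x₃, z⟩, -, φ, hφ, hlim⟩ := hK.tendsto_subseq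
    (x := fun n => (s.x₁ (n + 1), s.x₂ (n + 1), s.x₃ (n + 1), s.z (n + 1)))
    (fun n => by
      obtain ⟨c₁, c₂, c₃, c₄⟩ := hC y₁ y₂ y₃ y hy.2.2.2 (n + 1)
      exact ⟨mem_closedBall_sqrt (c₁.trans (hW n)), mem_closedBall_sqrt (c₂.trans (hW n)),
        mem_closedBall_sqrt (c₃.trans (hW n)), mem_closedBall_sqrt (c₄.trans (hW n))⟩)
  have hx₁ : Tendsto (fun n => s.x₁ (φ n + 1)) atTop (𝓝 x₁) := hlim.fst_nhds
  have hx₂ : Tendsto (fun n => s.x₂ (φ n + 1)) atTop (𝓝 x₂) := hlim.snd_nhds.fst_nhds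
  have hx₃ : Tendsto (fun n => s.x₃ (φ n + 1)) atTop (𝓝 x₃) := hlim.snd_nhds.snd_nhds.fst_nhds
  have hz : Tendsto (fun n => s.z (φ n + 1)) atTop (𝓝 z) := hlim.snd_nhds.snd_nhds.snd_nhds
  -- The cluster point now replaces the initial KKT point as reference: its merit is also monotone,
  -- and its limit is read off along the subsequence.
  have hkkt := hs.isKKT_of_tendsto hθ₁ hθ₂ hθ₃ hT₁ hT₂ hT₃ hr h₁ h₂ h₃ hφ hx₁ hx₂ hx₃ hz
  have hm := tendsto_zero_of_antitone_of_subseq (hanti hkkt) (fun n => hnn _ _ _ _ _) hφ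
    (tendsto_merit_zero hr h₂ h₃ hφ hx₁ hx₂ hx₃ hz)
  have hp : Tendsto (fun n => C * (phi P Q α s x₁ x₂ x₃ z (n + 1) + ‖res P s (n + 1)‖ ^ 2))
      atTop (𝓝 0) := by
    simpa using ((squeeze_zero (fun n => phi_nonneg hS₁ hT₁ hσ hτ hM x₁ x₂ x₃ z (n + 1))
      (fun n => phi_le_merit hS₂ hT₂ hT₃ hσ hα x₁ x₂ x₃ z (n + 1)) hm).add hr2).const_mul C
  have hfin := fun n => hC x₁ x₂ x₃ z hkkt.2.2.2 (n + 1)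
  refine ⟨x₁, x₂, x₃, z, hkkt, ?_, ?_, ?_, ?_⟩
  · exact (tendsto_add_atTop_iff_nat 1).1 (tendsto_sub_nhds_zero_iff.1
      (tendsto_zero_of_norm_sq_le (fun n => (hfin n).1) hp))
  · exact (tendsto_add_atTop_iff_nat 1).1 (tendsto_sub_nhds_zero_iff.1
      (tendsto_zero_of_norm_sq_le (fun n => (hfin n).2.1) hp))
  · exact (tendsto_add_atTop_iff_nat 1).1 (tendsto_sub_nhds_zero_iff.1
      (tendsto_zero_of_norm_sq_le (fun n => (hfin n).2.2.1) hp))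
  · exact (tendsto_add_atTop_iff_nat 1).1 (tendsto_sub_nhds_zero_iff.1
      (tendsto_zero_of_norm_sq_le (fun n => (hfin n).2.2.2) hp))

end Convergence

end SPADMM

theorem theorem1 {X₁ X₂ X₃ Z : Type*}
    [NormedAddCommGroup X₁] [InnerProductSpace ℝ X₁] [FiniteDimensional ℝ X₁]
    [NormedAddCommGroup X₂] [InnerProductSpace ℝ X₂] [FiniteDimensional ℝ X₂]
    [NormedAddCommGroup X₃] [InnerProductSpace ℝ X₃] [FiniteDimensional ℝ X₃]
    [NormedAddCommGroup Z] [InnerProductSpace ℝ Z] [FiniteDimensional ℝ Z]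
    (P : SPADMM.Problem X₁ X₂ X₃ Z) (Q : SPADMM.Params X₁ X₂ X₃)
    (hθ₁ : SPADMM.ClosedProperConvex P.θ₁)
    (hθ₂ : SPADMM.ClosedProperConvex P.θ₂)
    (hθ₃ : SPADMM.ClosedProperConvex P.θ₃)
    (hS₁ : Q.S₁.IsPositive) (hS₂ : SPADMM.PosDef Q.S₂) (hS₃ : Q.S₃.IsPositive)
    (hmono₁ : SPADMM.MonotoneWith P.θ₁ Q.S₁)
    (hmono₂ : SPADMM.MonotoneWith P.θ₂ Q.S₂)
    (hmono₃ : SPADMM.MonotoneWith P.θ₃ Q.S₃)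
    (hsol : ∃ x₁ x₂ x₃, P.IsOptimal x₁ x₂ x₃)
    (hCQ : P.ConstraintQualification)
    (hσ : 0 < Q.σ) (hτ : 0 < Q.τ)
    (hT₁ : Q.T₁.IsPositive) (hT₂ : Q.T₂.IsPositive) (hT₃ : Q.T₃.IsPositive)
    (s : SPADMM.Iterates X₁ X₂ X₃ Z) (hs : SPADMM.IsGenerated P Q s) :
    (∀ α : ℝ, 0 < α → α ≤ 1 → ∀ x₁ x₂ x₃ z, P.IsKKT x₁ x₂ x₃ z → ∀ k : ℕ, 1 ≤ k →
      SPADMM.t P Q α s (k + 1) +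
          min Q.τ (1 + Q.τ - Q.τ ^ 2) * Q.σ * Q.τ⁻¹ * ‖SPADMM.res P s (k + 1)‖ ^ 2 ≤
        SPADMM.merit P Q α s x₁ x₂ x₃ z k - SPADMM.merit P Q α s x₁ x₂ x₃ z (k + 1)) ∧
    (Q.τ < (1 + √5) / 2 →
      (∃ α : ℝ, 0 < α ∧ α ≤ 1 ∧
        SPADMM.PosDef ((1 / 2 : ℝ) • Q.S₁ + Q.T₁ + Q.σ • (P.A₁ ∘ₗ P.A₁.adjoint)) ∧
        SPADMM.PosDef (SPADMM.opH P Q α) ∧ SPADMM.PosDef (SPADMM.opM P Q α)) →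
      ∃ x₁ x₂ x₃ z, P.IsOptimal x₁ x₂ x₃ ∧ P.IsDualOptimal z ∧
        Tendsto s.x₁ atTop (𝓝 x₁) ∧ Tendsto s.x₂ atTop (𝓝 x₂) ∧
        Tendsto s.x₃ atTop (𝓝 x₃) ∧ Tendsto s.z atTop (𝓝 z)) := by
  refine ⟨fun α hα hα1 x₁ x₂ x₃ z h k hk => hs.t_add_le_merit_sub hθ₁ hθ₂ hθ₃ hS₁ hS₂ hS₃
    hmono₁ hmono₂ hmono₃ hσ hτ hT₁ hT₂ hT₃ hα hα1 h hk, ?_⟩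
  rintro hτ' ⟨α, hα, hα1, hG, hH, hM⟩
  obtain ⟨y₁, y₂, y₃, hy⟩ := hsol
  obtain ⟨y, hkkt⟩ := hy.exists_isKKT hθ₁ hθ₂ hθ₃ hCQ
  obtain ⟨x₁, x₂, x₃, z, h, l₁, l₂, l₃, lz⟩ := hs.exists_isKKT_tendsto hθ₁ hθ₂ hθ₃ hS₁ hS₂ hS₃
    hmono₁ hmono₂ hmono₃ hσ hτ hτ' hT₁ hT₂ hT₃ hα hα1 hG hH hM ⟨y₁, y₂, y₃, y, hkkt⟩
  exact ⟨x₁, x₂, x₃, z, h.isOptimal hθ₁ hθ₂ hθ₃, h.isDualOptimal hθ₁ hθ₂ hθ₃, l₁, l₂, l₃, lz⟩
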